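/- Let $l,k,n$ be integers with $0\le l<k<n$. For $\lambda\in\mathbb R^n$ let $\sigma_j(\lambda)$ be the $j$-th elementary symmetric function ($\sigma_0=1$, $\sigma_{-1}=0$). For a $C^2$ function $u$ on an open subset of $\mathbb R^n$ let $\lambda_1,\dots,\lambda_n$ be the eigenvalues of the Hessian $D^2u(x)$ and let $\eta=(\eta_1,\dots,\eta_n)$, $\eta_i=\sum_{j\ne i}\lambda_j$ (the eigenvalues of $(\Delta u)I-D^2u$). The function $u$ is called $(k-1)$-admissible in $\Omega$ if $\sigma_j(\eta)>0$ at every point of $\Omega$ for $j=1,\dots,k-1$. For every $m>0$, $N\ge 0$ and $K\ge 0$ there is a constant $C$, depending only on $n,k,l,m,N,K$, with the following property. Let $\alpha\ge 0$, let $\Omega\subset\mathbb R^n$ be a bounded domain, let $f\in C^2(\overline\Omega\times\mathbb R\times\mathbb R^n)$ with $f>0$, and let $u\in C^4(\Omega)\cap C^2(\overline\Omega)$ be a $(k-1)$-admissible solution of $$\frac{\sigma_k(\eta)+\alpha\,\sigma_{k-1}(\eta)}{\sigma_l(\eta)+\alpha\,\sigma_{l-1}(\eta)}=f(x,u,Du)\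 \text{ in }\Omega,\qquad u=0\ \text{ on }\partial\Omega .$$ Suppose that $|u|_{C^1(\Omega)}\le K$ and that, on the set $\Omega\times[-K,K]\times\{p\in\mathbb R^n:|p|\le K\}$, the $C^2$ norm of $f$ is at most $N$ and $f\ge m$. Then $$(-u)\,|D^2u|\le C\quad\text{in }\Omega .$$ Here $C^j(\overline U)$ denotes the functions in $C^j(U)$ all of whose derivatives of order at most $j$ extend continuously to $\overline U$. -/

import Mathlib

open Set Metric
open scoped NNReal ENNReal

noncomputable section

/-- `g ∈ C^j(closure U)` for an open set `U`: `g` is of class `C^j` in `U`, continuous on the closure,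
and every derivative of order at most `j` has a continuous extension from `U` to the closure. -/
def ContDiffUpToBoundary {V : Type*} [NormedAddCommGroup V] [NormedSpace ℝ V]
    (j : ℕ) (g : V → ℝ) (U : Set V) : Prop :=
  ContDiffOn ℝ j g U ∧ ContinuousOn g (closure U) ∧
    ∀ i ≤ j, ∃ G : V → ContinuousMultilinearMap ℝ (fun _ : Fin i => V) ℝ,
      ContinuousOn G (closure U) ∧ EqOn G (iteratedFDeriv ℝ i g) U

/-- The `C^j` norm of `g` over the set `U`: the sum over `i ≤ j` of the suprema over `U` of the norm
of the `i`-th derivative, with values in `[0, ∞]`. -/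
def cNorm {V : Type*} [NormedAddCommGroup V] [NormedSpace ℝ V]
    (j : ℕ) (g : V → ℝ) (U : Set V) : ℝ≥0∞ :=
  ∑ i ∈ Finset.range (j + 1), ⨆ x ∈ U, ‖iteratedFDeriv ℝ i g x‖ₑ

/-- The Hessian matrix `(∂ᵢ∂ⱼ u (x))`. -/
def hessianMatrix {n : ℕ} (u : EuclideanSpace ℝ (Fin n) → ℝ) (x : EuclideanSpace ℝ (Fin n)) :
    Matrix (Fin n) (Fin n) ℝ :=
  Matrix.of fun i j =>
    iteratedFDeriv ℝ 2 u x ![EuclideanSpace.single i (1 : ℝ), EuclideanSpace.single j (1 : ℝ)]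

/-- The eigenvalues `λ₁, …, λₙ` of the Hessian, with multiplicity (where `u` is `C²` the Hessian is
symmetric, so that its characteristic polynomial has `n` real roots). -/
def hessianEigenvalues {n : ℕ} (u : EuclideanSpace ℝ (Fin n) → ℝ)
    (x : EuclideanSpace ℝ (Fin n)) : Multiset ℝ :=
  (hessianMatrix u x).charpoly.roots

/-- The numbers `ηᵢ = ∑_{j ≠ i} λⱼ`. -/
def etaEigenvalues {n : ℕ} (u : EuclideanSpace ℝ (Fin n) → ℝ)
    (x : EuclideanSpace ℝ (Fin n)) : Multiset ℝ :=
  (hessianEigenvalues u x).map fun t => (hessianEigenvalues u x).sum - t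

/-- The sum Hessian function `S_m = σ_m + α σ_{m-1}`, with the convention `σ_{-1} = 0`
(`Multiset.esymm` is the elementary symmetric function, with `σ_0 = 1`). -/
def sumHessian (α : ℝ) : ℕ → Multiset ℝ → ℝ
  | 0, s => s.esymm 0
  | m + 1, s => s.esymm (m + 1) + α * s.esymm m

/-- `u` is `j`-admissible in `Ω`: `σ_m(η) > 0` in `Ω` for `m = 1, …, j`. -/
def IsAdmissible {n : ℕ} (j : ℕ) (u : EuclideanSpace ℝ (Fin n) → ℝ)
    (Ω : Set (EuclideanSpace ℝ (Fin n))) : Prop :=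
  ∀ x ∈ Ω, ∀ m : ℕ, 1 ≤ m → m ≤ j → 0 < (etaEigenvalues u x).esymm m

/-- `u` solves the sum Hessian quotient equation `S_k(η) / S_l(η) = f(x, u, Du)` in `Ω`. -/
def SolvesSumHessianQuotient {n : ℕ} (k l : ℕ) (α : ℝ)
    (f : EuclideanSpace ℝ (Fin n) × ℝ × EuclideanSpace ℝ (Fin n) → ℝ)
    (u : EuclideanSpace ℝ (Fin n) → ℝ) (Ω : Set (EuclideanSpace ℝ (Fin n))) : Prop :=
  ∀ x ∈ Ω, sumHessian α k (etaEigenvalues u x) / sumHessian α l (etaEigenvalues u x) =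
    f (x, u x, gradient u x)

end

/-!
The extra variable `α` turns the sum Hessian operator into an ordinary one:
`σ_k(η) + α σ_{k-1}(η)` is the elementary symmetric polynomial `σ_k` of the `n + 1` numbers
`(η, α)`. For a `(k-1)`-admissible solution with positive right-hand side these numbers lie in the
Gårding cone `Γ_k` (`inGardingCone_etaAlpha`), so that the equation reads
`log (σ_k/σ_l)(η, α) = log f(x, u, Du)` with `(η, α) ∈ Γ_k ⊂ ℝ^{n+1}`, and no constant below depends
on `α`.

On `Γ_k` the function `log (σ_k/σ_l)` is concave and monotone. This is proved in the form of a
tangent-plane inequality (`exists_support_log_esym_div`), by induction on `k` from Newton's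
inequality and Euler's identity. Through Birkhoff's theorem on doubly stochastic matrices it becomes
a tangent-plane inequality on symmetric matrices (`exists_majorant_log_sumQuotient`). Since `k < n`,
the cone `Γ_k` contains vectors with one slightly negative `η`-entry, all other `η`-entries equal to
`1`, and last entry `0`; testing the tangent plane with them shows that the linearized operator,
`∑ᵢ dᵢ ∂ᵢ²` in a basis of eigenvectors of the Hessian, is uniformly elliptic: `dᵢ ≥ c (1 + ∑ⱼ dⱼ)`.

The tangent-plane inequality also replaces the differentiation of the equation. With `dᵢ` frozen at
a point `x₀`, the function `log f(x, u, Du) - ∑ᵢ dᵢ u_ii` has a local maximum at `x₀`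
(`isLocalMax_log_sub_linearization`), and the first and second order conditions there are the once
and twice differentiated equation, the concavity term having already been dropped with its good sign.

The estimate is the maximum principle for Pogorelov's function
`log (-u) + log u_ξξ + (A/2) |Du|²`. It has an interior maximum over points and unit vectors, because
`u` vanishes on the boundary and `D²u` is bounded, and `ξ` may be taken to be a top eigenvector. The
term `(A/2) |Du|²` contributes `A ∑ᵢ dᵢ λᵢ²`, which by uniform ellipticity controls
`(1 + ∑ᵢ dᵢ) λ_max²`; with `A = 1/(4K² + 1)` the gradient terms are absorbed through the first order
condition, and what remains is a quadratic inequality for `(-u) λ_max`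
(`exists_bound_at_isLocalMax`). Finally `Δu` is bounded below (`neg_le_sum_eigenvalues`), so that an
upper bound for the eigenvalues of `D²u` bounds its norm.
-/

/-! ### Elementary symmetric polynomials and Newton's inequality -/

/-- The elementary symmetric polynomial `σ_k` of the numbers `x i`, `i ∈ s`. -/
def esym {ι : Type*} (s : Finset ι) (x : ι → ℝ) (k : ℕ) : ℝ :=
  ∑ t ∈ s.powersetCard k, ∏ i ∈ t, x i

section ElementarySymmetric

variable {ι : Type*}

lemma esym_zero (s : Finset ι) (x : ι → ℝ) : esym s x 0 = 1 := by
  simp [esym]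

lemma esym_one (s : Finset ι) (x : ι → ℝ) : esym s x 1 = ∑ i ∈ s, x i := by
  simp [esym, Finset.powersetCard_one]

lemma esym_eq_zero_of_card_lt {s : Finset ι} {k : ℕ} (h : s.card < k) (x : ι → ℝ) :
    esym s x k = 0 := by
  simp [esym, Finset.powersetCard_eq_empty.mpr h]

lemma esym_const_one (s : Finset ι) (k : ℕ) : esym s (fun _ => 1) k = s.card.choose k := by
  simp [esym]

lemma esym_congr {s : Finset ι} {x y : ι → ℝ} (h : ∀ i ∈ s, x i = y i) (k : ℕ) :
    esym s x k = esym s y k := by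
  refine Finset.sum_congr rfl fun t ht => Finset.prod_congr rfl fun i hi => h i ?_
  exact (Finset.mem_powersetCard.mp ht).1 hi

lemma esym_smul (s : Finset ι) (c : ℝ) (x : ι → ℝ) (k : ℕ) :
    esym s (fun i => c * x i) k = c ^ k * esym s x k := by
  unfold esym
  rw [Finset.mul_sum]
  refine Finset.sum_congr rfl fun t ht => ?_
  rw [Finset.prod_mul_distrib, Finset.prod_const, (Finset.mem_powersetCard.mp ht).2]

lemma multiset_esymm_map (s : Finset ι) (x : ι → ℝ) (k : ℕ) :
    (s.val.map x).esymm k = esym s x k :=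
  Finset.esymm_map_val x s k

variable [DecidableEq ι]

lemma esym_insert {s : Finset ι} {a : ι} (ha : a ∉ s) (x : ι → ℝ) (k : ℕ) :
    esym (insert a s) x (k + 1) = x a * esym s x k + esym s x (k + 1) := by
  unfold esym
  rw [Finset.powersetCard_succ_insert ha, Finset.sum_union, add_comm, Finset.mul_sum,
    Finset.sum_image]
  · congr 1
    refine Finset.sum_congr rfl fun t ht => ?_
    rw [Finset.prod_insert fun h => ha ((Finset.mem_powersetCard.mp ht).1 h)]
  · intro t ht t' ht' h
    have h1 : a ∉ t := fun h => ha ((Finset.mem_powersetCard.mp ht).1 h)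
    have h2 : a ∉ t' := fun h => ha ((Finset.mem_powersetCard.mp ht').1 h)
    rw [← Finset.erase_insert h1, ← Finset.erase_insert h2, h]
  · rw [Finset.disjoint_left]
    intro t ht ht'
    obtain ⟨t', _, rfl⟩ := Finset.mem_image.mp ht'
    exact ha ((Finset.mem_powersetCard.mp ht).1 (Finset.mem_insert_self _ _))

lemma esym_eq_erase {s : Finset ι} {a : ι} (ha : a ∈ s) (x : ι → ℝ) (k : ℕ) :
    esym s x (k + 1) = x a * esym (s.erase a) x k + esym (s.erase a) x (k + 1) := by
  conv_lhs => rw [← Finset.insert_erase ha]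
  exact esym_insert (Finset.notMem_erase a s) x k

/-- Euler's identity for the homogeneous polynomial `σ_{k+1}`. -/
lemma sum_mul_esym_erase (s : Finset ι) (x : ι → ℝ) (k : ℕ) :
    ∑ i ∈ s, x i * esym (s.erase i) x k = (k + 1) * esym s x (k + 1) := by
  induction s using Finset.induction_on generalizing k with
  | empty => rw [esym_eq_zero_of_card_lt (by simp)]; simp
  | insert a s ha ih =>
    rw [Finset.sum_insert ha, Finset.erase_insert ha]
    have key : ∀ i ∈ s, (insert a s).erase i = insert a (s.erase i) := fun i hi =>
      Finset.erase_insert_of_ne fun h => ha (h ▸ hi)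
    have hna : ∀ i, a ∉ s.erase i := fun i h => ha (Finset.mem_of_mem_erase h)
    cases k with
    | zero => simp [esym_zero, esym_one, Finset.sum_insert ha]
    | succ k =>
      have : ∀ i ∈ s, x i * esym ((insert a s).erase i) x (k + 1)
          = x a * (x i * esym (s.erase i) x k) + x i * esym (s.erase i) x (k + 1) := by
        intro i hi
        rw [key i hi, esym_insert (hna i)]
        ring
      rw [Finset.sum_congr rfl this, Finset.sum_add_distrib, ← Finset.mul_sum, ih k, ih (k + 1),
        esym_insert ha]
      push_cast
      ring

end ElementarySymmetric

section Newton

open Polynomial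

lemma splits_derivative {p : ℝ[X]} (hp : p.Splits) : (derivative p).Splits := by
  rcases Nat.eq_zero_or_pos p.natDegree with h | h
  · rw [Polynomial.eq_C_of_natDegree_eq_zero h]
    simp
  · rw [splits_iff_card_roots] at hp ⊢
    refine le_antisymm (card_roots' _) ?_
    have := card_roots_le_derivative p
    have := natDegree_derivative_lt h.ne'
    omega

lemma splits_iterate_derivative {p : ℝ[X]} (hp : p.Splits) (d : ℕ) :
    (derivative^[d] p).Splits := by
  induction d with
  | zero => simpa
  | succ d ih =>
    rw [Function.iterate_succ_apply']
    exact splits_derivative ih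

/-- For a real-rooted `p`, the inequality `p p'' ≤ (p')²` at the origin. -/
lemma two_mul_coeff_zero_mul_coeff_two_le {p : ℝ[X]} (hp : p.Splits) :
    2 * (p.coeff 0 * p.coeff 2) ≤ p.coeff 1 ^ 2 := by
  have key : ∀ s : Multiset ℝ, 2 * (((s.map fun a => X - C a).prod : ℝ[X]).coeff 0 *
      ((s.map fun a => X - C a).prod : ℝ[X]).coeff 2) ≤
      ((s.map fun a => X - C a).prod : ℝ[X]).coeff 1 ^ 2 := by
    intro s
    induction s using Multiset.induction_on with
    | empty => simp [coeff_one]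
    | cons r s ih =>
      simp only [Multiset.map_cons, Multiset.prod_cons, sub_mul, coeff_sub, coeff_C_mul,
        coeff_X_mul_zero, coeff_X_mul]
      set h := (s.map fun a => X - C a).prod
      nlinarith [sq_nonneg (h.coeff 0), mul_nonneg (sq_nonneg r) (sub_nonneg.mpr ih)]
  rw [hp.eq_prod_roots]
  simp only [coeff_C_mul]
  nlinarith [mul_nonneg (sq_nonneg p.leadingCoeff) (sub_nonneg.mpr (key p.roots))]

/-- A weak form of Newton's inequality, for arbitrary real numbers. -/
lemma esym_mul_esym_le_sq {ι : Type*} (s : Finset ι) (x : ι → ℝ) (k : ℕ) :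
    esym s x k * esym s x (k + 2) ≤ esym s x (k + 1) ^ 2 := by
  rcases lt_or_ge s.card (k + 2) with h | h
  · rw [esym_eq_zero_of_card_lt h]
    simpa using sq_nonneg _
  obtain ⟨D, hD⟩ := Nat.exists_eq_add_of_le h
  set p : ℝ[X] := ∏ i ∈ s, (X + C (x i)) with hpdef
  have hp : p.Splits := Splits.prod fun i _ => Splits.X_add_C _
  have hc : ∀ r ≤ k + 2, p.coeff (D + r) = esym s x (k + 2 - r) := by
    intro r hr
    rw [hpdef, Finset.prod_X_add_C_coeff _ _ (by omega)]
    have : s.card - (D + r) = k + 2 - r := by omega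
    rw [this]
    rfl
  have hq := two_mul_coeff_zero_mul_coeff_two_le (splits_iterate_derivative hp D)
  simp only [coeff_iterate_derivative, nsmul_eq_mul] at hq
  rw [add_comm 0 D, add_comm 1 D, add_comm 2 D, hc 0 (by omega), hc 1 (by omega), hc 2 (by omega)]
    at hq
  -- The three binomial factors are `D!`, `(D+1)!` and `(D+2)!/2`.
  have f0 : ((D + 0).descFactorial D : ℝ) = D.factorial := by simp [Nat.descFactorial_self]
  have f1 : ((D + 1).descFactorial D : ℝ) = (D + 1) * D.factorial := by
    have := Nat.factorial_mul_descFactorial (Nat.le_succ D)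
    simp only [Nat.succ_eq_add_one, Nat.add_sub_cancel_left, Nat.factorial_one, one_mul] at this
    rw [this, Nat.factorial_succ]; push_cast; ring
  have f2 : 2 * ((D + 2).descFactorial D : ℝ) = (D + 2) * (D + 1) * D.factorial := by
    have := Nat.factorial_mul_descFactorial (Nat.le_add_right D 2)
    rw [Nat.add_sub_cancel_left, Nat.factorial_two] at this
    have h2 : ((2 * (D + 2).descFactorial D : ℕ) : ℝ) = ((D + 2).factorial : ℕ) := by rw [this]
    push_cast [Nat.factorial_succ] at h2
    rw [h2]; ring
  have e1 : k + 2 - 1 = k + 1 := by omega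
  have e2 : k + 2 - 2 = k := by omega
  simp only [e1, e2, Nat.sub_zero] at hq
  rw [f0, f1] at hq
  have hF : (0 : ℝ) < D.factorial := by positivity
  set a := esym s x k
  set b := esym s x (k + 1)
  set c := esym s x (k + 2)
  have h3 : (D.factorial : ℝ) ^ 2 * (D + 1) * ((D + 2) * (a * c)) ≤
      (D.factorial : ℝ) ^ 2 * (D + 1) * ((D + 1) * b ^ 2) := by
    calc _ = (D.factorial : ℝ) * c * ((D + 2) * (D + 1) * D.factorial * a) := by ring
      _ = 2 * (D.factorial * c * (((D + 2).descFactorial D : ℝ) * a)) := by rw [← f2]; ring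
      _ ≤ _ := hq
      _ = _ := by ring
  have h4 : ((D : ℝ) + 2) * (a * c) ≤ (D + 1) * b ^ 2 :=
    le_of_mul_le_mul_left h3 (by positivity)
  have hD0 : (0 : ℝ) ≤ D := Nat.cast_nonneg D
  by_contra hcon
  push Not at hcon
  nlinarith [sq_nonneg b]

end Newton

/-! ### Gårding cones and supporting planes of Hessian quotients -/

/-- `x` lies in the Gårding cone `Γ_k` of the variables indexed by `s`. -/
def InGardingCone {ι : Type*} (s : Finset ι) (k : ℕ) (x : ι → ℝ) : Prop :=
  ∀ j ≤ k, 0 < esym s x j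

section GardingCone

variable {ι : Type*}

lemma InGardingCone.mono {s : Finset ι} {k l : ℕ} {x : ι → ℝ} (h : InGardingCone s k x)
    (hl : l ≤ k) : InGardingCone s l x :=
  fun j hj => h j (hj.trans hl)

lemma InGardingCone.smul {s : Finset ι} {k : ℕ} {x : ι → ℝ} (h : InGardingCone s k x)
    {c : ℝ} (hc : 0 < c) : InGardingCone s k (fun i => c * x i) := by
  intro j hj
  rw [esym_smul]
  exact mul_pos (pow_pos hc j) (h j hj)

lemma esym_of_eq_zero {s t : Finset ι} (hst : s ⊆ t) {x : ι → ℝ}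
    (h : ∀ i ∈ t, i ∉ s → x i = 0) (k : ℕ) : esym t x k = esym s x k := by
  refine (Finset.sum_subset (Finset.powersetCard_mono hst) fun r hr hr' => ?_).symm
  rw [Finset.mem_powersetCard] at hr hr'
  obtain ⟨i, hi, his⟩ := Finset.not_subset.mp fun h => hr' ⟨h, hr.2⟩
  exact Finset.prod_eq_zero hi (h i (hr.1 hi) his)

variable [DecidableEq ι]

/-- Removing a variable maps `Γ_{k+1}` to `Γ_k`. If `σ_{j+1}(x|i) ≤ 0` for the first such `j`, then
`σ_{j+1}(x) > 0` and `σ_{j+2}(x) > 0` contradict Newton's inequality for `x|i`. -/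
lemma InGardingCone.erase {s : Finset ι} {k : ℕ} {x : ι → ℝ} (h : InGardingCone s (k + 1) x)
    {i : ι} (hi : i ∈ s) : InGardingCone (s.erase i) k x := by
  intro j
  induction j with
  | zero => intro _; simp [esym_zero]
  | succ j ih =>
    intro hj
    have hp := ih (by omega)
    have h1 := h (j + 1) (by omega)
    have h2 := h (j + 1 + 1) (by omega)
    rw [esym_eq_erase hi] at h1 h2
    have hN := esym_mul_esym_le_sq (s.erase i) x j
    by_contra hcon
    push Not at hcon
    set p := esym (s.erase i) x j
    set a := esym (s.erase i) x (j + 1)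
    set b := esym (s.erase i) x (j + 2)
    have h3 : p * (x i * a + b) > 0 := mul_pos hp h2
    have h4 : (-a) * (x i * p + a) ≥ 0 := mul_nonneg (by linarith) h1.le
    nlinarith

/-- The quotient `σ_{k+1} / σ_k` is the minimum of a family of linear functions with nonnegative
coefficients; in particular it is concave and monotone on `Γ_k`. By Euler's identity
`(k+2) σ_{k+2}/σ_{k+1} = ∑ᵢ (xᵢ - xᵢ²/(xᵢ + qᵢ))` with `qᵢ = (σ_{k+1}/σ_k)(x|i)`, so that the
statement follows by induction on `k` and the inequality `x²/y ≥ 2ax - a²y`. -/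
lemma exists_support_esym_div (k : ℕ) (s : Finset ι) (x : ι → ℝ) (hx : InGardingCone s k x) :
    ∃ w : ι → ℝ, (∀ i, 0 ≤ w i) ∧ ∑ i ∈ s, w i * x i = esym s x (k + 1) / esym s x k ∧
      ∀ y, InGardingCone s k y → esym s y (k + 1) / esym s y k ≤ ∑ i ∈ s, w i * y i := by
  induction k generalizing s with
  | zero =>
    exact ⟨fun _ => 1, fun _ => zero_le_one, by simp [esym_zero, esym_one],
      fun y _ => by simp [esym_zero, esym_one]⟩
  | succ k ih =>
    have hw : ∀ i, ∃ w : ι → ℝ, i ∈ s → (∀ j, 0 ≤ w j) ∧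
        ∑ j ∈ s.erase i, w j * x j = esym (s.erase i) x (k + 1) / esym (s.erase i) x k ∧
        ∀ y, InGardingCone (s.erase i) k y →
          esym (s.erase i) y (k + 1) / esym (s.erase i) y k ≤ ∑ j ∈ s.erase i, w j * y j := by
      intro i
      by_cases hi : i ∈ s
      · obtain ⟨w, hw⟩ := ih (s.erase i) (hx.erase hi)
        exact ⟨w, fun _ => hw⟩
      · exact ⟨0, fun h => absurd h hi⟩
    choose w hw using hw
    set a : ι → ℝ := fun i => x i * esym (s.erase i) x k / esym s x (k + 1) with ha
    -- The Euler identity, divided by `(k+2) σ_{k+1}`.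
    have euler : ∀ y : ι → ℝ, esym s y (k + 1 + 1) / esym s y (k + 1) =
        ((k : ℝ) + 2)⁻¹ * ∑ i ∈ s, y i * esym (s.erase i) y (k + 1) / esym s y (k + 1) := by
      intro y
      rw [← Finset.sum_div, sum_mul_esym_erase]
      have : (k : ℝ) + 2 ≠ 0 := by positivity
      push_cast
      field_simp
      ring
    have rearrange : ∀ y : ι → ℝ,
        ∑ i ∈ s, (((k : ℝ) + 2)⁻¹ * ((1 - a i) ^ 2 + ∑ j ∈ s.erase i, a j ^ 2 * w j i)) * y i =
        ((k : ℝ) + 2)⁻¹ * ∑ i ∈ s, ((1 - a i) ^ 2 * y i + a i ^ 2 * ∑ j ∈ s.erase i, w i j * y j) := by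
      intro y
      have e1 : ∑ i ∈ s, (∑ j ∈ s.erase i, a j ^ 2 * w j i) * y i =
          ∑ i ∈ s, a i ^ 2 * ∑ j ∈ s.erase i, w i j * y j := by
        simp_rw [Finset.sum_mul, Finset.mul_sum]
        rw [Finset.sum_comm' (t' := s) (s' := fun i => s.erase i)]
        · exact Finset.sum_congr rfl fun i _ => Finset.sum_congr rfl fun j _ => by ring
        · intro i j
          simp only [Finset.mem_erase]
          tauto
      rw [Finset.sum_add_distrib, ← e1, ← Finset.sum_add_distrib, Finset.mul_sum]
      exact Finset.sum_congr rfl fun i _ => by ring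
    refine ⟨fun i => ((k : ℝ) + 2)⁻¹ * ((1 - a i) ^ 2 + ∑ j ∈ s.erase i, a j ^ 2 * w j i), ?_, ?_, ?_⟩
    · intro i
      have : 0 ≤ ∑ j ∈ s.erase i, a j ^ 2 * w j i := Finset.sum_nonneg fun j hj =>
        mul_nonneg (sq_nonneg _) ((hw j (Finset.mem_of_mem_erase hj)).1 i)
      positivity
    · rw [rearrange, euler]
      congr 1
      refine Finset.sum_congr rfl fun i hi => ?_
      have hp : 0 < esym (s.erase i) x k := hx.erase hi k le_rfl
      have hS : 0 < esym s x (k + 1) := hx (k + 1) le_rfl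
      have hS' := esym_eq_erase hi x k
      rw [(hw i hi).2.1]
      simp only [ha]
      set p := esym (s.erase i) x k
      set r := esym (s.erase i) x (k + 1)
      set S := esym s x (k + 1)
      have hr : r = S - x i * p := by linarith
      rw [hr]
      field_simp
      ring
    · intro y hy
      rw [rearrange, euler]
      refine mul_le_mul_of_nonneg_left (Finset.sum_le_sum fun i hi => ?_) (by positivity)
      have hp : 0 < esym (s.erase i) y k := hy.erase hi k le_rfl
      have hS : 0 < esym s y (k + 1) := hy (k + 1) le_rfl
      have hS' := esym_eq_erase hi y k
      refine le_trans ?_ (add_le_add_right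
        (mul_le_mul_of_nonneg_left ((hw i hi).2.2 y (hy.erase hi)) (sq_nonneg (a i))) _)
      set p := esym (s.erase i) y k
      set r := esym (s.erase i) y (k + 1)
      set S := esym s y (k + 1)
      have hr : r = S - y i * p := by linarith
      rw [hr, ← sub_nonneg]
      have : (1 - a i) ^ 2 * y i + a i ^ 2 * ((S - y i * p) / p) - y i * (S - y i * p) / S =
          (y i * p - a i * S) ^ 2 / (p * S) := by
        field_simp
        ring
      rw [this]
      positivity

/-- The tangent-plane inequality for the concave function `log (σ_k / σ_l)` on `Γ_k`; the
coefficients are nonnegative, and homogeneity pins the constant `k - l`. -/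
lemma exists_support_log_esym_div {k l : ℕ} (hlk : l ≤ k) (s : Finset ι) (x : ι → ℝ)
    (hx : InGardingCone s k x) :
    ∃ w : ι → ℝ, (∀ i, 0 ≤ w i) ∧ ∑ i ∈ s, w i * x i = k - l ∧
      ∀ y, InGardingCone s k y → Real.log (esym s y k / esym s y l) -
        Real.log (esym s x k / esym s x l) ≤ ∑ i ∈ s, w i * y i - (k - l) := by
  induction k, hlk using Nat.le_induction with
  | base =>
    refine ⟨0, fun _ => le_rfl, by simp, fun y hy => ?_⟩
    rw [div_self (hy l le_rfl).ne', div_self (hx l le_rfl).ne']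
    simp
  | succ k hlk ih =>
    obtain ⟨w, hw0, hw1, hw2⟩ := ih (hx.mono (Nat.le_succ k))
    obtain ⟨v, hv0, hv1, hv2⟩ := exists_support_esym_div k s x (hx.mono (Nat.le_succ k))
    have hq : ∀ z, InGardingCone s (k + 1) z → 0 < esym s z (k + 1) / esym s z k := fun z hz =>
      div_pos (hz _ le_rfl) (hz _ (Nat.le_succ k))
    have hlog : ∀ z, InGardingCone s (k + 1) z → Real.log (esym s z (k + 1) / esym s z l) =
        Real.log (esym s z (k + 1) / esym s z k) + Real.log (esym s z k / esym s z l) := by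
      intro z hz
      have h1 := hz k (Nat.le_succ k)
      have h2 := hz l (hlk.trans (Nat.le_succ k))
      have h3 := hz (k + 1) le_rfl
      rw [← Real.log_mul (by positivity) (by positivity)]
      congr 1
      field_simp
    set q := esym s x (k + 1) / esym s x k with hqdef
    have hq0 : 0 < q := hq x hx
    have split : ∀ z : ι → ℝ, ∑ i ∈ s, (w i + v i / q) * z i =
        ∑ i ∈ s, w i * z i + (∑ i ∈ s, v i * z i) / q := by
      intro z
      rw [Finset.sum_div, ← Finset.sum_add_distrib]
      exact Finset.sum_congr rfl fun i _ => by ring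
    refine ⟨fun i => w i + v i / q, fun i => add_nonneg (hw0 i) (div_nonneg (hv0 i) hq0.le), ?_, ?_⟩
    · rw [split, hw1, hv1, div_self hq0.ne']
      push_cast
      ring
    · intro y hy
      rw [split, hlog y hy, hlog x hx]
      have h1 := hw2 y (hy.mono (Nat.le_succ k))
      have h2 := hv2 y (hy.mono (Nat.le_succ k))
      have h3 : Real.log (esym s y (k + 1) / esym s y k) - Real.log q ≤
          (∑ i ∈ s, v i * y i) / q - 1 := by
        rw [← Real.log_div (hq y hy).ne' hq0.ne']
        refine (Real.log_le_sub_one_of_pos (div_pos (hq y hy) hq0)).trans ?_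
        gcongr
      push_cast
      linarith

/-- Uniform ellipticity: if `k < #s`, the coefficients of a supporting plane of `log (σ_k/σ_l)` at a
point where `σ_k/σ_l ≤ B` satisfy `∑_{j ∈ s, j ≠ i} w_j ≥ c (1 + w_i)`. The plane is tested with the
vector that has a small negative entry at `i`, entries `1` on the rest of `s`, and `0` elsewhere;
it lies in `Γ_k`. -/
lemma exists_support_lower_bound {k l : ℕ} (hlk : l < k) (B : ℝ) {s t : Finset ι} (hst : s ⊆ t)
    (hk : k < s.card) :
    ∃ c > 0, ∀ (w : ι → ℝ) (Q : ℝ), (∀ i, 0 ≤ w i) → 0 < Q → Q ≤ B →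
      (∀ y, InGardingCone t k y → Real.log (esym t y k / esym t y l) - Real.log Q ≤
        ∑ i ∈ t, w i * y i - (k - l)) →
      ∀ i ∈ s, c * (1 + w i) ≤ ∑ j ∈ s.erase i, w j := by
  set c := s.card with hc
  set δ : ℝ := (2 ^ c)⁻¹ with hδ
  have hδ0 : 0 < δ := by positivity
  let g : ℕ → ℝ := fun j => Nat.casesOn j 1 fun j => -δ * (c - 1).choose j + (c - 1).choose (j + 1)
  set y : ι → ι → ℝ := fun i j => if j = i then -δ else if j ∈ s then 1 else 0 with hy
  have hg : ∀ i ∈ s, ∀ j, esym t (y i) j = g j := by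
    intro i hi j
    rw [esym_of_eq_zero hst]
    · cases j with
      | zero => simp [g, esym_zero]
      | succ j =>
        have h1 : ∀ j ∈ s.erase i, y i j = 1 := fun j hj => by
          simp [hy, Finset.ne_of_mem_erase hj, Finset.mem_of_mem_erase hj]
        rw [esym_eq_erase hi, esym_congr h1, esym_congr h1, esym_const_one, esym_const_one,
          Finset.card_erase_of_mem hi, ← hc]
        simp [g, hy]
    · intro j _ hjs
      have : j ≠ i := fun h => hjs (h ▸ hi)
      simp [hy, this, hjs]
  have hg0 : ∀ j ≤ k, 0 < g j := by
    intro j hj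
    cases j with
    | zero => simp [g]
    | succ j =>
      have h1 : ((c - 1).choose j : ℝ) ≤ 2 ^ (c - 1) := by
        exact_mod_cast Nat.choose_le_two_pow (c - 1) j
      have h2 : (1 : ℝ) ≤ (c - 1).choose (j + 1) := by
        exact_mod_cast Nat.choose_pos (by omega : j + 1 ≤ c - 1)
      have h3 : (2 : ℝ) ^ (c - 1) < 2 ^ c := pow_lt_pow_right₀ one_lt_two (by omega)
      have h4 : δ * ((c - 1).choose j : ℝ) < 1 := by
        calc _ ≤ δ * 2 ^ (c - 1) := by gcongr
          _ < δ * 2 ^ c := by gcongr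
          _ = 1 := inv_mul_cancel₀ (by positivity)
      simp only [g]
      linarith
  set R := g k / g l with hR
  have hR0 : 0 < R := div_pos (hg0 k le_rfl) (hg0 l hlk.le)
  -- The factor `τ` makes the left side of the tangent-plane inequality at `τ y` at least `1`.
  set τ : ℝ := Real.exp (|Real.log R| + |Real.log B|) with hτ
  have hτ0 : 0 < τ := Real.exp_pos _
  refine ⟨min δ τ⁻¹, lt_min hδ0 (inv_pos.mpr hτ0), ?_⟩
  intro w Q hw hQ hQB hsup i hi
  have hyG : InGardingCone t k (y i) := fun j hj => by rw [hg i hi]; exact hg0 j hj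
  have h1 := hsup _ (hyG.smul hτ0)
  rw [esym_smul, esym_smul, hg i hi, hg i hi] at h1
  have h2 : τ ^ k * g k / (τ ^ l * g l) = τ ^ (k - l) * R := by
    rw [hR, mul_div_mul_comm, pow_sub₀ _ hτ0.ne' hlk.le, div_eq_mul_inv]
  have hkl : (1 : ℝ) ≤ k - l := by
    have : (l : ℝ) + 1 ≤ k := by exact_mod_cast hlk
    linarith
  rw [h2, Real.log_mul (by positivity) hR0.ne', Real.log_pow, hτ, Real.log_exp, ← hτ,
    Nat.cast_sub hlk.le] at h1
  have h3 : Real.log Q ≤ Real.log B := Real.log_le_log hQ hQB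
  have h4 : |Real.log R| + |Real.log B| ≤ ((k : ℝ) - l) * (|Real.log R| + |Real.log B|) :=
    le_mul_of_one_le_left (by positivity) hkl
  have h5 : ∑ j ∈ t, w j * (τ * y i j) = τ * (∑ j ∈ s.erase i, w j - δ * w i) := by
    rw [← Finset.sum_subset hst (f := fun j => w j * (τ * y i j))]
    · rw [← Finset.add_sum_erase _ _ hi, mul_sub, Finset.mul_sum]
      have : ∀ j ∈ s.erase i, w j * (τ * y i j) = τ * w j := fun j hj => by
        simp [hy, Finset.ne_of_mem_erase hj, Finset.mem_of_mem_erase hj, mul_comm]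
      rw [Finset.sum_congr rfl this]
      simp only [hy, if_true]
      ring
    · intro j _ hjs
      have : j ≠ i := fun h => hjs (h ▸ hi)
      simp [hy, this, hjs]
  rw [h5] at h1
  have h6 : 1 ≤ τ * (∑ j ∈ s.erase i, w j - δ * w i) := by
    have := neg_abs_le (Real.log R)
    have := le_abs_self (Real.log B)
    linarith
  have h7 : τ⁻¹ ≤ ∑ j ∈ s.erase i, w j - δ * w i := by
    rwa [inv_le_iff_one_le_mul₀' hτ0]
  have h8 : min δ τ⁻¹ * w i ≤ δ * w i := mul_le_mul_of_nonneg_right (min_le_left _ _) (hw i)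
  have h9 : min δ τ⁻¹ ≤ τ⁻¹ := min_le_right _ _
  linarith

end GardingCone

/-! ### The sum Hessian quotient on symmetric matrices -/

section EtaVariables

variable {n : ℕ}

/-- The vector `(η, α)` of `n + 1` variables attached to `λ`, with `ηᵢ = ∑_{j ≠ i} λⱼ`. The sum
Hessian function is an elementary symmetric polynomial of it: `σ_k(η, α) = σ_k(η) + α σ_{k-1}(η)`. -/
noncomputable def etaAlpha (α : ℝ) (lam : Fin n → ℝ) : Option (Fin n) → ℝ :=
  fun o => o.elim α fun i => ∑ j, lam j - lam i

/-- The quotient `S_k(η) / S_l(η)` as a function of `λ`. -/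
noncomputable def sumQuotient (k l : ℕ) (α : ℝ) (lam : Fin n → ℝ) : ℝ :=
  esym Finset.univ (etaAlpha α lam) k / esym Finset.univ (etaAlpha α lam) l

lemma esym_comp_equiv {ι κ : Type*} [Fintype ι] [Fintype κ] (e : ι ≃ κ) (x : κ → ℝ) (k : ℕ) :
    esym Finset.univ (x ∘ e) k = esym Finset.univ x k := by
  rw [← multiset_esymm_map, ← multiset_esymm_map, ← Multiset.map_map]
  congr 2
  exact Multiset.map_univ_val_equiv e

lemma esym_map {ι κ : Type*} (e : ι ↪ κ) (s : Finset ι) (x : κ → ℝ) (k : ℕ) :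
    esym (s.map e) x k = esym s (x ∘ e) k := by
  rw [← multiset_esymm_map, ← multiset_esymm_map, Finset.map_val, Multiset.map_map]

lemma sumHessian_eq_esym (α : ℝ) (lam : Fin n → ℝ) (k : ℕ) :
    sumHessian α k (Finset.univ.val.map fun i => ∑ j, lam j - lam i) =
      esym Finset.univ (etaAlpha α lam) k := by
  have hu : (Finset.univ : Finset (Option (Fin n))) =
      insert none (Finset.univ.map Function.Embedding.some) := by
    ext o; cases o <;> simp
  cases k with
  | zero => rw [sumHessian, multiset_esymm_map, esym_zero, esym_zero]
  | succ k =>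
    rw [sumHessian, multiset_esymm_map, multiset_esymm_map, hu, esym_insert (by simp), esym_map,
      esym_map, add_comm]
    rfl

lemma etaAlpha_comp_perm (α : ℝ) (lam : Fin n → ℝ) (σ : Equiv.Perm (Fin n)) :
    etaAlpha α (lam ∘ σ) = etaAlpha α lam ∘ σ.optionCongr := by
  funext o
  cases o with
  | none => rfl
  | some i => simp [etaAlpha, Equiv.sum_comp σ lam]

lemma sum_mul_etaAlpha (α : ℝ) (w : Option (Fin n) → ℝ) (lam : Fin n → ℝ) :
    ∑ o, w o * etaAlpha α lam o =
      w none * α + ∑ i, (∑ j ∈ Finset.univ.erase i, w (some j)) * lam i := by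
  rw [Fintype.sum_option]
  congr 1
  simp_rw [etaAlpha, Option.elim, Finset.sum_mul]
  rw [Finset.sum_comm' (t' := Finset.univ) (s' := fun i => Finset.univ.erase i)]
  · refine Finset.sum_congr rfl fun i _ => ?_
    rw [← Finset.mul_sum, Finset.sum_erase_eq_sub (Finset.mem_univ i)]
  · intro i j
    simp [eq_comm]

/-- A lower bound for a linear function on the permutation matrices holds on all doubly stochastic
matrices (Birkhoff). -/
lemma le_sum_of_forall_perm {S : Matrix (Fin n) (Fin n) ℝ} (hS : S ∈ doublyStochastic ℝ (Fin n))
    (d μ : Fin n → ℝ) (r : ℝ) (h : ∀ σ : Equiv.Perm (Fin n), r ≤ ∑ i, d i * μ (σ i)) :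
    r ≤ ∑ i, d i * ∑ j, S i j * μ j := by
  obtain ⟨w, hw0, hw1, rfl⟩ := exists_eq_sum_perm_of_mem_doublyStochastic hS
  have h1 : ∀ i, ∑ j, (∑ σ : Equiv.Perm (Fin n), w σ • σ.permMatrix ℝ) i j * μ j =
      ∑ σ : Equiv.Perm (Fin n), w σ * μ (σ i) := by
    intro i
    simp_rw [Matrix.sum_apply, Finset.sum_mul]
    rw [Finset.sum_comm]
    refine Finset.sum_congr rfl fun σ _ => ?_
    rw [Finset.sum_eq_single (σ i)]
    · simp [Equiv.Perm.permMatrix, PEquiv.toMatrix_apply]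
    · intro j _ hj
      simp [Equiv.Perm.permMatrix, PEquiv.toMatrix_apply, hj.symm]
    · simp
  simp_rw [h1, Finset.mul_sum]
  rw [Finset.sum_comm]
  calc r = ∑ σ : Equiv.Perm (Fin n), w σ * r := by rw [← Finset.sum_mul, hw1, one_mul]
    _ ≤ ∑ σ : Equiv.Perm (Fin n), w σ * ∑ i, d i * μ (σ i) :=
      Finset.sum_le_sum fun σ _ => mul_le_mul_of_nonneg_left (h σ) (hw0 σ)
    _ = _ := by
      refine Finset.sum_congr rfl fun σ _ => ?_
      rw [Finset.mul_sum]
      exact Finset.sum_congr rfl fun i _ => by ring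

/-- The tangent-plane inequality for `log (S_k/S_l)` as a function of symmetric matrices, at a
diagonal matrix with entries `lam`: the numbers `∑ⱼ Sᵢⱼ μⱼ` stand for the diagonal entries of a
symmetric matrix with eigenvalues `μ`. The linearized operator is uniformly elliptic. -/
lemma exists_majorant_log_sumQuotient {k l : ℕ} (hlk : l < k) (hkn : k < n) (B : ℝ) :
    ∃ c > 0, ∀ (α : ℝ) (lam : Fin n → ℝ), 0 ≤ α →
      InGardingCone Finset.univ k (etaAlpha α lam) → sumQuotient k l α lam ≤ B →
      ∃ d : Fin n → ℝ, (∀ i, c * (1 + ∑ j, d j) ≤ d i) ∧ (∀ i, 0 ≤ d i) ∧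
        ∑ i, d i * lam i ≤ k - l ∧
        ∀ (μ : Fin n → ℝ) (S : Matrix (Fin n) (Fin n) ℝ), S ∈ doublyStochastic ℝ (Fin n) →
          InGardingCone Finset.univ k (etaAlpha α μ) →
          Real.log (sumQuotient k l α μ) - Real.log (sumQuotient k l α lam) ≤
            ∑ i, d i * (∑ j, S i j * μ j - lam i) := by
  obtain ⟨c, hc, hell⟩ := exists_support_lower_bound hlk B (k := k)
    (s := Finset.univ.map (Function.Embedding.some (α := Fin n))) (Finset.subset_univ _)
    (by simpa using hkn)
  have hn : (1 : ℝ) ≤ n := by exact_mod_cast (by omega : 1 ≤ n)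
  refine ⟨c / ((1 + c) * n), by positivity, fun α lam hα hlam hB => ?_⟩
  obtain ⟨w, hw0, hw1, hw2⟩ := exists_support_log_esym_div hlk.le Finset.univ _ hlam
  have hell' := hell w _ hw0 (div_pos (hlam k le_rfl) (hlam l hlk.le)) hB hw2
  set d : Fin n → ℝ := fun i => ∑ j ∈ Finset.univ.erase i, w (some j) with hd
  have hd0 : ∀ i, 0 ≤ d i := fun i => Finset.sum_nonneg fun j _ => hw0 _
  set W := ∑ j, w (some j) with hW
  have hdW : ∀ i, d i = W - w (some i) := fun i =>
    Finset.sum_erase_eq_sub (Finset.mem_univ i)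
  have hW0 : 0 ≤ W := Finset.sum_nonneg fun j _ => hw0 _
  have hdc : ∀ i, c * (1 + w (some i)) ≤ d i := by
    intro i
    refine (hell' (some i) (by simp)).trans_eq ?_
    rw [Finset.sum_erase_eq_sub (by simp), Finset.sum_map, hdW]
    rfl
  have hsum : ∑ j, d j ≤ n * W := by
    calc ∑ j, d j ≤ ∑ j : Fin n, W := Finset.sum_le_sum fun j _ => by
          rw [hdW]; linarith [hw0 (some j)]
      _ = n * W := by simp
  rw [sum_mul_etaAlpha] at hw1
  refine ⟨d, fun i => ?_, hd0, ?_, fun μ S hS hμ => ?_⟩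
  · have h1 := hdc i
    rw [div_mul_eq_mul_div, div_le_iff₀ (by positivity)]
    have h2 : c * (1 + W) ≤ d i * (1 + c) := by
      have := hdW i
      nlinarith
    calc c * (1 + ∑ j, d j) ≤ c * (n * (1 + W)) := by
          gcongr; linarith
      _ = c * (1 + W) * n := by ring
      _ ≤ d i * (1 + c) * n := by gcongr
      _ = _ := by ring
  · have := mul_nonneg (hw0 none) hα
    linarith
  · have key := le_sum_of_forall_perm hS d μ (Real.log (sumQuotient k l α μ) -
      Real.log (sumQuotient k l α lam) + ∑ i, d i * lam i) fun σ => by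
        have h1 : ∀ j, esym Finset.univ (etaAlpha α (μ ∘ σ)) j =
            esym Finset.univ (etaAlpha α μ) j := fun j => by
          rw [etaAlpha_comp_perm, esym_comp_equiv]
        have h2 := hw2 (etaAlpha α (μ ∘ σ)) fun j hj => by rw [h1]; exact hμ j hj
        rw [h1, h1, sum_mul_etaAlpha] at h2
        simp only [sumQuotient, Function.comp] at h2 ⊢
        linarith
    simp_rw [mul_sub, Finset.sum_sub_distrib]
    linarith

end EtaVariables

/-! ### Eigenvalues of the Hessian -/

section HessianEigenvalues

open scoped InnerProductSpace

variable {n : ℕ}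

lemma hessianMatrix_eq (u : EuclideanSpace ℝ (Fin n) → ℝ) (x : EuclideanSpace ℝ (Fin n))
    (i j : Fin n) : hessianMatrix u x i j =
      fderiv ℝ (fderiv ℝ u) x (EuclideanSpace.single i 1) (EuclideanSpace.single j 1) := by
  simp [hessianMatrix, iteratedFDeriv_two_apply]

/-- An orthonormal basis of eigenvectors of the Hessian. -/
lemma exists_hessian_eigenbasis (u : EuclideanSpace ℝ (Fin n) → ℝ)
    (x : EuclideanSpace ℝ (Fin n))
    (hsymm : ∀ v w, fderiv ℝ (fderiv ℝ u) x v w = fderiv ℝ (fderiv ℝ u) x w v) :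
    ∃ (b : OrthonormalBasis (Fin n) ℝ (EuclideanSpace ℝ (Fin n))) (lam : Fin n → ℝ),
      (∀ i v, fderiv ℝ (fderiv ℝ u) x v (b i) = lam i * ⟪b i, v⟫_ℝ) ∧
      etaEigenvalues u x = Finset.univ.val.map fun i => ∑ j, lam j - lam i := by
  have hA : (hessianMatrix u x).IsHermitian := by
    ext i j
    simp [hessianMatrix_eq, hsymm (EuclideanSpace.single i 1)]
  have hroots : hessianEigenvalues u x = Finset.univ.val.map hA.eigenvalues := by
    rw [hessianEigenvalues, hA.roots_charpoly_eq_eigenvalues]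
    rfl
  refine ⟨hA.eigenvectorBasis, hA.eigenvalues, fun i v => ?_, ?_⟩
  · have h1 := hA.mulVec_eigenvectorBasis i
    have expand : ∀ v : EuclideanSpace ℝ (Fin n),
        v = ∑ j, v j • EuclideanSpace.single j (1 : ℝ) := by
      intro v
      ext j
      simp [Finset.sum_apply, Pi.single_apply]
    have h2 : ∀ k, fderiv ℝ (fderiv ℝ u) x (EuclideanSpace.single k 1) (hA.eigenvectorBasis i) =
        hA.eigenvalues i * hA.eigenvectorBasis i k := by
      intro k
      have := congrFun h1 k
      simp only [Matrix.mulVec, dotProduct, hessianMatrix_eq, Pi.smul_apply, smul_eq_mul] at this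
      rw [← this]
      conv_lhs => rw [expand (hA.eigenvectorBasis i)]
      simp [map_sum, mul_comm]
    conv_lhs => rw [expand v]
    simp only [map_sum, map_smul, sum_apply, smul_apply,
      smul_eq_mul, h2]
    rw [PiLp.inner_apply, Finset.mul_sum]
    refine Finset.sum_congr rfl fun k _ => ?_
    simp
    ring
  · rw [etaEigenvalues, hroots, Multiset.map_map]
    rfl

section

variable {E : Type*} [NormedAddCommGroup E] [InnerProductSpace ℝ E]
  {b : OrthonormalBasis (Fin n) ℝ E} {lam : Fin n → ℝ} {B : E →L[ℝ] E →L[ℝ] ℝ}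

lemma bilin_eq_sum_eigenvalues (hB : ∀ i v, B v (b i) = lam i * ⟪b i, v⟫_ℝ) (v w : E) :
    B v w = ∑ j, lam j * (⟪b j, v⟫_ℝ * ⟪b j, w⟫_ℝ) := by
  conv_lhs => rw [← b.sum_repr' w]
  simp only [map_sum, map_smul, hB, smul_eq_mul]
  exact Finset.sum_congr rfl fun j _ => by ring

/-- The diagonal entries of a quadratic form in an orthonormal basis are the image of its
eigenvalues under a doubly stochastic matrix. -/
lemma exists_doublyStochastic (c : OrthonormalBasis (Fin n) ℝ E)
    (hB : ∀ i v, B v (b i) = lam i * ⟪b i, v⟫_ℝ) :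
    ∃ S ∈ doublyStochastic ℝ (Fin n), ∀ i, B (c i) (c i) = ∑ j, S i j * lam j := by
  refine ⟨Matrix.of fun i j => ⟪b j, c i⟫_ℝ ^ 2, ?_, fun i => ?_⟩
  · rw [mem_doublyStochastic_iff_sum]
    refine ⟨fun i j => sq_nonneg _, fun i => ?_, fun j => ?_⟩
    · have := b.sum_sq_norm_inner_right (c i)
      simpa [c.orthonormal.1 i] using this
    · have := c.sum_sq_norm_inner_left (b j)
      simpa [b.orthonormal.1 j] using this
  · rw [bilin_eq_sum_eigenvalues hB]
    exact Finset.sum_congr rfl fun j _ => by simp; ring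

lemma bilin_self_le (hB : ∀ i v, B v (b i) = lam i * ⟪b i, v⟫_ℝ) {M : ℝ} (hM : ∀ i, lam i ≤ M)
    {v : E} (hv : ‖v‖ = 1) : B v v ≤ M := by
  rw [bilin_eq_sum_eigenvalues hB]
  calc ∑ j, lam j * (⟪b j, v⟫_ℝ * ⟪b j, v⟫_ℝ) ≤ ∑ j, M * (⟪b j, v⟫_ℝ * ⟪b j, v⟫_ℝ) :=
        Finset.sum_le_sum fun j _ => mul_le_mul_of_nonneg_right (hM j) (mul_self_nonneg _)
    _ = M := by
      rw [← Finset.mul_sum]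
      have := b.sum_sq_norm_inner_right v
      simp only [Real.norm_eq_abs, sq_abs, hv, one_pow] at this
      simp_rw [← sq, this, mul_one]

lemma abs_bilin_le (hB : ∀ i v, B v (b i) = lam i * ⟪b i, v⟫_ℝ) {M : ℝ} (hM : ∀ i, |lam i| ≤ M)
    (hM0 : 0 ≤ M) (v w : E) : |B v w| ≤ M * (‖v‖ * ‖w‖) := by
  rw [bilin_eq_sum_eigenvalues hB]
  have key : ∑ j, |⟪b j, v⟫_ℝ| * |⟪b j, w⟫_ℝ| ≤ ‖v‖ * ‖w‖ := by
    refine abs_le_of_sq_le_sq' ?_ (by positivity) |>.2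
    refine (Finset.sum_mul_sq_le_sq_mul_sq _ _ _).trans_eq ?_
    have h1 := b.sum_sq_norm_inner_right v
    have h2 := b.sum_sq_norm_inner_right w
    simp only [Real.norm_eq_abs] at h1 h2
    rw [h1, h2, mul_pow]
  calc |∑ j, lam j * (⟪b j, v⟫_ℝ * ⟪b j, w⟫_ℝ)|
      ≤ ∑ j, |lam j * (⟪b j, v⟫_ℝ * ⟪b j, w⟫_ℝ)| := Finset.abs_sum_le_sum_abs _ _
    _ ≤ ∑ j, M * (|⟪b j, v⟫_ℝ| * |⟪b j, w⟫_ℝ|) := Finset.sum_le_sum fun j _ => by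
        rw [abs_mul, abs_mul]; gcongr; exact hM j
    _ ≤ M * (‖v‖ * ‖w‖) := by rw [← Finset.mul_sum]; gcongr

end

end HessianEigenvalues

/-! ### Directional derivatives and conditions at maxima -/

section DirectionalDerivatives

open Filter Topology

/-- Second-order necessary condition at an interior maximum of a function of one variable. -/
lemma IsLocalMax.hasDerivAt_eq_zero_and_nonpos {p p' : ℝ → ℝ} {c t : ℝ} (hmax : IsLocalMax p t)
    (h1 : ∀ᶠ s in 𝓝 t, HasDerivAt p (p' s) s) (h2 : HasDerivAt p' c t) : p' t = 0 ∧ c ≤ 0 := by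
  have h0 : p' t = 0 := hmax.hasDerivAt_eq_zero h1.self_of_nhds
  refine ⟨h0, ?_⟩
  by_contra hc
  push Not at hc
  have hd : deriv p =ᶠ[𝓝 t] p' := h1.mono fun s hs => hs.deriv
  have hdd : deriv (deriv p) t = c := by rw [hd.deriv_eq, h2.deriv]
  have hmin := isLocalMin_of_deriv_deriv_pos (hdd ▸ hc) (hd.self_of_nhds.trans h0)
    h1.self_of_nhds.continuousAt
  -- Both a local maximum and a local minimum: `p` is locally constant.
  have hconst : p =ᶠ[𝓝 t] fun _ => p t := by
    filter_upwards [hmax, hmin] with s hs hs' using le_antisymm hs hs'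
  have : p' =ᶠ[𝓝 t] fun _ => 0 := by
    filter_upwards [hd, hconst.eventuallyEq_nhds] with s hs hs'
    rw [← hs, hs'.deriv_eq, deriv_const]
  have := h2.unique ((hasDerivAt_const t (0 : ℝ)).congr_of_eventuallyEq this)
  linarith

variable {E : Type*} [NormedAddCommGroup E] [NormedSpace ℝ E]

/-- The directional derivative `∂_v g`. -/
noncomputable def dirDeriv (v : E) (g : E → ℝ) : E → ℝ := fun x => fderiv ℝ g x v

lemma hasDerivAt_line {F : Type*} [NormedAddCommGroup F] [NormedSpace ℝ F] {g : E → F}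
    {x v : E} {t : ℝ} (h : DifferentiableAt ℝ g (x + t • v)) :
    HasDerivAt (fun s : ℝ => g (x + s • v)) (fderiv ℝ g (x + t • v) v) t := by
  have h1 : HasDerivAt (fun s : ℝ => x + s • v) v t := by
    simpa using ((hasDerivAt_id t).smul_const v).const_add x
  exact h.hasFDerivAt.comp_hasDerivAt t h1

lemma ContDiffOn.dirDeriv {m : ℕ} {g : E → ℝ} {Ω : Set E} (hΩ : IsOpen Ω)
    (hg : ContDiffOn ℝ (m + 1 : ℕ) g Ω) (v : E) : ContDiffOn ℝ m (dirDeriv v g) Ω :=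
  (hg.fderiv_of_isOpen hΩ (m := m) (by norm_cast)).clm_apply contDiffOn_const

lemma differentiableAt_of_contDiffOn {m : ℕ} {g : E → ℝ} {Ω : Set E} (hΩ : IsOpen Ω)
    (hg : ContDiffOn ℝ (m + 1 : ℕ) g Ω) {x : E} (hx : x ∈ Ω) : DifferentiableAt ℝ g x :=
  (hg.contDiffAt (hΩ.mem_nhds hx)).differentiableAt (by simp)

lemma dirDeriv_dirDeriv {g : E → ℝ} {Ω : Set E} (hΩ : IsOpen Ω) (hg : ContDiffOn ℝ 2 g Ω)
    {x : E} (hx : x ∈ Ω) (v w : E) :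
    dirDeriv v (dirDeriv w g) x = fderiv ℝ (fderiv ℝ g) x v w := by
  have : DifferentiableAt ℝ (fderiv ℝ g) x :=
    ((hg.contDiffAt (hΩ.mem_nhds hx)).fderiv_right (m := 1) (by norm_num)).differentiableAt
      (by simp)
  have h := (this.hasFDerivAt.clm_apply (hasFDerivAt_const w x)).fderiv
  unfold dirDeriv
  rw [h]
  simp

lemma fderiv_fderiv_comm {g : E → ℝ} {Ω : Set E} (hΩ : IsOpen Ω) (hg : ContDiffOn ℝ 2 g Ω)
    {x : E} (hx : x ∈ Ω) (v w : E) :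
    fderiv ℝ (fderiv ℝ g) x v w = fderiv ℝ (fderiv ℝ g) x w v :=
  ((hg.contDiffAt (hΩ.mem_nhds hx)).isSymmSndFDerivAt (by simp)) v w

lemma dirDeriv_comm {g : E → ℝ} {Ω : Set E} (hΩ : IsOpen Ω) (hg : ContDiffOn ℝ 2 g Ω)
    (v w : E) : EqOn (dirDeriv v (dirDeriv w g)) (dirDeriv w (dirDeriv v g)) Ω := fun x hx => by
  rw [dirDeriv_dirDeriv hΩ hg hx, dirDeriv_dirDeriv hΩ hg hx, fderiv_fderiv_comm hΩ hg hx]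

lemma Set.EqOn.dirDeriv {g h : E → ℝ} {Ω : Set E} (hΩ : IsOpen Ω) (hgh : EqOn g h Ω) (v : E) :
    EqOn (dirDeriv v g) (dirDeriv v h) Ω := fun x hx => by
  have : g =ᶠ[𝓝 x] h := eventually_of_mem (hΩ.mem_nhds hx) hgh
  simp only [_root_.dirDeriv, this.fderiv_eq]

lemma eventually_line_mem {Ω : Set E} (hΩ : IsOpen Ω) {x : E} (hx : x ∈ Ω) (v : E) :
    ∀ᶠ t : ℝ in 𝓝 0, x + t • v ∈ Ω := by
  have : Continuous fun t : ℝ => x + t • v := by fun_prop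
  exact this.continuousAt.eventually (hΩ.mem_nhds (by simpa using hx))

lemma IsLocalMax.comp_line {g : E → ℝ} {x : E} (h : IsLocalMax g x) (v : E) :
    IsLocalMax (fun t : ℝ => g (x + t • v)) 0 := by
  have hc : Continuous fun t : ℝ => x + t • v := by fun_prop
  have h' : IsMaxFilter g (𝓝 (x + (0 : ℝ) • v)) (x + (0 : ℝ) • v) := by
    simpa [IsLocalMax] using h
  exact IsMaxFilter.comp_tendsto (g := fun t : ℝ => x + t • v) h' hc.continuousAt

lemma hasDerivAt_dirDeriv_line {g : E → ℝ} {Ω : Set E} (hΩ : IsOpen Ω) (hg : ContDiffOn ℝ 2 g Ω)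
    {x : E} (hx : x ∈ Ω) (v : E) :
    (∀ᶠ t : ℝ in 𝓝 0, HasDerivAt (fun s : ℝ => g (x + s • v)) (dirDeriv v g (x + t • v)) t) ∧
    HasDerivAt (fun s : ℝ => dirDeriv v g (x + s • v)) (dirDeriv v (dirDeriv v g) x) 0 := by
  constructor
  · filter_upwards [eventually_line_mem hΩ hx v] with t ht
    exact hasDerivAt_line (differentiableAt_of_contDiffOn (m := 1) hΩ hg ht)
  · have h1 : DifferentiableAt ℝ (dirDeriv v g) (x + (0 : ℝ) • v) := by
      rw [zero_smul, add_zero]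
      exact differentiableAt_of_contDiffOn (m := 0) hΩ (ContDiffOn.dirDeriv (m := 1) hΩ hg v) hx
    have h2 := hasDerivAt_line h1
    simpa [dirDeriv] using h2

/-- First and second order conditions, in a direction `v`, at a maximum of
`log (-u) + log w + (A/2) ∑ₖ gₖ²`. -/
lemma conditions_of_isLocalMax_log {κ : Type*} [Fintype κ] {Ω : Set E} (hΩ : IsOpen Ω) {x : E}
    (hx : x ∈ Ω) {u w : E → ℝ} {g : κ → E → ℝ} (hu : ContDiffOn ℝ 2 u Ω)
    (hw : ContDiffOn ℝ 2 w Ω) (hg : ∀ k, ContDiffOn ℝ 2 (g k) Ω) (hux : u x < 0) (hwx : 0 < w x)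
    (A : ℝ) (hmax : IsLocalMax
      (fun y => Real.log (-u y) + Real.log (w y) + A / 2 * ∑ k, g k y ^ 2) x) (v : E) :
    dirDeriv v u x / u x + dirDeriv v w x / w x + A * ∑ k, g k x * dirDeriv v (g k) x = 0 ∧
    dirDeriv v (dirDeriv v u) x / u x - (dirDeriv v u x / u x) ^ 2 +
      dirDeriv v (dirDeriv v w) x / w x - (dirDeriv v w x / w x) ^ 2 +
      A * ∑ k, (dirDeriv v (g k) x ^ 2 + g k x * dirDeriv v (dirDeriv v (g k)) x) ≤ 0 := by
  obtain ⟨u1, u2⟩ := hasDerivAt_dirDeriv_line hΩ hu hx v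
  obtain ⟨w1, w2⟩ := hasDerivAt_dirDeriv_line hΩ hw hx v
  have g1 := fun k => (hasDerivAt_dirDeriv_line hΩ (hg k) hx v).1
  have g2 := fun k => (hasDerivAt_dirDeriv_line hΩ (hg k) hx v).2
  have hne : ∀ᶠ t : ℝ in 𝓝 0, u (x + t • v) ≠ 0 ∧ w (x + t • v) ≠ 0 := by
    have e1 : ContinuousAt (fun t : ℝ => u (x + t • v)) 0 := u1.self_of_nhds.continuousAt
    have e2 : ContinuousAt (fun t : ℝ => w (x + t • v)) 0 := w1.self_of_nhds.continuousAt
    exact (e1.eventually_ne (by simpa using hux.ne)).and (e2.eventually_ne (by simpa using hwx.ne'))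
  have key := IsLocalMax.hasDerivAt_eq_zero_and_nonpos (hmax.comp_line v)
    (p' := fun t => dirDeriv v u (x + t • v) / u (x + t • v) +
      dirDeriv v w (x + t • v) / w (x + t • v) +
      A * ∑ k, g k (x + t • v) * dirDeriv v (g k) (x + t • v))
    (c := dirDeriv v (dirDeriv v u) x / u x - (dirDeriv v u x / u x) ^ 2 +
      dirDeriv v (dirDeriv v w) x / w x - (dirDeriv v w x / w x) ^ 2 +
      A * ∑ k, (dirDeriv v (g k) x ^ 2 + g k x * dirDeriv v (dirDeriv v (g k)) x)) ?_ ?_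
  · simpa using key
  · filter_upwards [u1, w1, eventually_all.mpr g1, hne] with t hu1 hw1 hg1 hne
    have e1 := hu1.fun_neg.log (neg_ne_zero.mpr hne.1)
    have e2 := hw1.log hne.2
    have e3 := (HasDerivAt.fun_sum (u := Finset.univ) fun k _ => (hg1 k).pow 2).const_mul (A / 2)
    refine ((e1.add e2).add e3).congr_deriv ?_
    rw [neg_div_neg_eq, Finset.mul_sum, Finset.mul_sum]
    congr 1
    refine Finset.sum_congr rfl fun k _ => ?_
    push_cast
    ring
  · have hne0 := hne.self_of_nhds
    have e1 := u2.div u1.self_of_nhds hne0.1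
    have e2 := w2.div w1.self_of_nhds hne0.2
    have e3 := (HasDerivAt.fun_sum (u := Finset.univ) fun k _ =>
      (g1 k).self_of_nhds.mul (g2 k)).const_mul A
    refine ((e1.add e2).add e3).congr_deriv ?_
    simp only [zero_smul, add_zero] at hne0 ⊢
    have : ∀ k, dirDeriv v (g k) x ^ 2 + g k x * dirDeriv v (dirDeriv v (g k)) x =
      dirDeriv v (g k) x * dirDeriv v (g k) x + g k x * dirDeriv v (dirDeriv v (g k)) x :=
      fun k => by ring
    simp_rw [this]
    have h1 := hne0.1
    have h2 := hne0.2
    field_simp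
    ring

/-- First and second order conditions, in a direction `v`, at a maximum of
`log f(x, u, ∑ₖ gₖ bₖ) - ∑ᵢ dᵢ qᵢ`. -/
lemma conditions_of_isLocalMax_comp {κ ι F : Type*} [Fintype κ] [Fintype ι] [NormedAddCommGroup F]
    [NormedSpace ℝ F] {Ω : Set E} (hΩ : IsOpen Ω)
    {x : E} (hx : x ∈ Ω) {u : E → ℝ} {g : κ → E → ℝ} {q : ι → E → ℝ} (hu : ContDiffOn ℝ 2 u Ω)
    (hg : ∀ k, ContDiffOn ℝ 2 (g k) Ω) (hq : ∀ i, ContDiffOn ℝ 2 (q i) Ω) (b : κ → F) (d : ι → ℝ)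
    {f : E × ℝ × F → ℝ} (hf : ContDiffOn ℝ 2 f (Ω ×ˢ univ)) {Y : E → E × ℝ × F}
    (hY : Y = fun y => (y, u y, ∑ k, g k y • b k)) (hfpos : 0 < f (Y x))
    (hmax : IsLocalMax (fun y => Real.log (f (Y y)) - ∑ i, d i * q i y) x) (v : E)
    {Y' Y'' : E × ℝ × F} (hY' : Y' = (v, dirDeriv v u x, ∑ k, dirDeriv v (g k) x • b k))
    (hY'' : Y'' = (0, dirDeriv v (dirDeriv v u) x, ∑ k, dirDeriv v (dirDeriv v (g k)) x • b k)) :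
    ∑ i, d i * dirDeriv v (q i) x = fderiv ℝ f (Y x) Y' / f (Y x) ∧
    (fderiv ℝ (fderiv ℝ f) (Y x) Y' Y' + fderiv ℝ f (Y x) Y'') / f (Y x) -
      (fderiv ℝ f (Y x) Y' / f (Y x)) ^ 2 ≤ ∑ i, d i * dirDeriv v (dirDeriv v (q i)) x := by
  obtain ⟨u1, u2⟩ := hasDerivAt_dirDeriv_line hΩ hu hx v
  have g1 := fun k => (hasDerivAt_dirDeriv_line hΩ (hg k) hx v).1
  have g2 := fun k => (hasDerivAt_dirDeriv_line hΩ (hg k) hx v).2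
  have q1 := fun i => (hasDerivAt_dirDeriv_line hΩ (hq i) hx v).1
  have q2 := fun i => (hasDerivAt_dirDeriv_line hΩ (hq i) hx v).2
  have hO : IsOpen (Ω ×ˢ (univ : Set (ℝ × F))) := hΩ.prod isOpen_univ
  set Z : ℝ → E × ℝ × F := fun t => (v, dirDeriv v u (x + t • v),
    ∑ k, dirDeriv v (g k) (x + t • v) • b k) with hZ
  have hZ0 : Z 0 = Y' := by simp [hZ, hY']
  have Y1 : ∀ᶠ t : ℝ in 𝓝 0, HasDerivAt (fun s : ℝ => Y (x + s • v)) (Z t) t := by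
    filter_upwards [u1, eventually_all.mpr g1] with t hu1 hg1
    have e0 : HasDerivAt (fun s : ℝ => x + s • v) v t := by
      simpa using ((hasDerivAt_id t).smul_const v).const_add x
    have e3 := HasDerivAt.fun_sum (u := Finset.univ) fun k _ => (hg1 k).smul_const (b k)
    rw [hY]
    exact e0.prodMk (hu1.prodMk e3)
  have Z1 : HasDerivAt Z Y'' 0 := by
    have e3 := HasDerivAt.fun_sum (u := Finset.univ) fun k _ => (g2 k).smul_const (b k)
    rw [hY'']
    exact (hasDerivAt_const (0 : ℝ) v).prodMk (u2.prodMk e3)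
  have f1 : ∀ᶠ t : ℝ in 𝓝 0, HasDerivAt (fun s : ℝ => f (Y (x + s • v)))
      (fderiv ℝ f (Y (x + t • v)) (Z t)) t := by
    filter_upwards [Y1, eventually_line_mem hΩ hx v] with t hY1 ht
    have hmem : Y (x + t • v) ∈ Ω ×ˢ (univ : Set (ℝ × F)) := by rw [hY]; exact ⟨ht, mem_univ _⟩
    have hd : HasFDerivAt f (fderiv ℝ f (Y (x + t • v))) (Y (x + t • v)) :=
      (differentiableAt_of_contDiffOn (m := 1) hO hf hmem).hasFDerivAt
    exact HasFDerivAt.comp_hasDerivAt (f := fun s : ℝ => Y (x + s • v)) t hd hY1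
  have hmem0 : Y (x + (0 : ℝ) • v) ∈ Ω ×ˢ (univ : Set (ℝ × F)) := by
    rw [hY]; exact ⟨by simpa using hx, mem_univ _⟩
  have f2 : HasDerivAt (fun t : ℝ => fderiv ℝ f (Y (x + t • v)) (Z t))
      (fderiv ℝ (fderiv ℝ f) (Y x) Y' Y' + fderiv ℝ f (Y x) Y'') 0 := by
    have h1 : DifferentiableAt ℝ (fderiv ℝ f) (Y (x + (0 : ℝ) • v)) :=
      ((hf.contDiffAt (hO.mem_nhds hmem0)).fderiv_right (m := 1) (by norm_num)).differentiableAt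
        (by simp)
    have h2 := (HasFDerivAt.comp_hasDerivAt (f := fun s : ℝ => Y (x + s • v)) (0 : ℝ)
      h1.hasFDerivAt Y1.self_of_nhds).clm_apply Z1
    simpa [hZ0] using h2
  have hne : ∀ᶠ t : ℝ in 𝓝 0, f (Y (x + t • v)) ≠ 0 :=
    f1.self_of_nhds.continuousAt.eventually_ne (by simpa using hfpos.ne')
  have key := IsLocalMax.hasDerivAt_eq_zero_and_nonpos (hmax.comp_line v)
    (p' := fun t => fderiv ℝ f (Y (x + t • v)) (Z t) / f (Y (x + t • v)) -
      ∑ i, d i * dirDeriv v (q i) (x + t • v))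
    (c := (fderiv ℝ (fderiv ℝ f) (Y x) Y' Y' + fderiv ℝ f (Y x) Y'') / f (Y x) -
      (fderiv ℝ f (Y x) Y' / f (Y x)) ^ 2 - ∑ i, d i * dirDeriv v (dirDeriv v (q i)) x) ?_ ?_
  · simp only [zero_smul, add_zero, hZ0] at key
    exact ⟨by linarith [key.1], by linarith [key.2]⟩
  · filter_upwards [f1, eventually_all.mpr q1, hne] with t hf1 hq1 hne
    exact (hf1.log hne).sub
      (HasDerivAt.fun_sum (u := Finset.univ) fun i _ => (hq1 i).const_mul (d i))
  · refine ((f2.div f1.self_of_nhds hne.self_of_nhds).sub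
      (HasDerivAt.fun_sum (u := Finset.univ) fun i _ => (q2 i).const_mul (d i))).congr_deriv ?_
    simp only [zero_smul, add_zero, hZ0]
    have := hfpos.ne'
    field_simp
end DirectionalDerivatives

/-! ### The algebra of the maximum principle -/

section PointwiseEstimate

open Filter Topology

lemma mul_le_of_quadratic_le {a K L κ U V T : ℝ} (ha : 0 < a) (haK : a ≤ K) (hL : 0 < L)
    (hκ : 0 < κ) (hU : 0 ≤ U) (hV : 0 ≤ V) (hT : 0 ≤ T)
    (h : κ * (L ^ 2 * (1 + T)) ≤ U / a + T * (3 * K ^ 2 / a ^ 2) + V * L) :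
    a * L ≤ 1 + (U * K + 3 * K ^ 2 + V * K) / κ := by
  have hK : 0 ≤ K := ha.le.trans haK
  set D := U * K + 3 * K ^ 2 + V * K with hD
  have hD0 : 0 ≤ D := by positivity
  rcases le_total (a * L) 1 with h1 | h1
  · have : 0 ≤ D / κ := by positivity
    linarith
  have h2 : κ * (a * L) ^ 2 * (1 + T) ≤ U * a + T * (3 * K ^ 2) + V * a * (a * L) := by
    calc κ * (a * L) ^ 2 * (1 + T) = a ^ 2 * (κ * (L ^ 2 * (1 + T))) := by ring
      _ ≤ a ^ 2 * (U / a + T * (3 * K ^ 2 / a ^ 2) + V * L) :=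
        mul_le_mul_of_nonneg_left h (sq_nonneg a)
      _ = _ := by field_simp
  have e1 : U * a ≤ U * K * (a * L) * (1 + T) := by
    calc U * a ≤ U * K := mul_le_mul_of_nonneg_left haK hU
      _ ≤ U * K * (a * L) := le_mul_of_one_le_right (by positivity) h1
      _ ≤ _ := le_mul_of_one_le_right (by positivity) (by linarith)
  have e2 : T * (3 * K ^ 2) ≤ 3 * K ^ 2 * (a * L) * (1 + T) := by
    calc T * (3 * K ^ 2) ≤ 3 * K ^ 2 * (1 + T) := by nlinarith [sq_nonneg K]
      _ ≤ 3 * K ^ 2 * (1 + T) * (a * L) := le_mul_of_one_le_right (by positivity) h1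
      _ = _ := by ring
  have e3 : V * a * (a * L) ≤ V * K * (a * L) * (1 + T) := by
    calc V * a * (a * L) ≤ V * K * (a * L) :=
          mul_le_mul_of_nonneg_right (mul_le_mul_of_nonneg_left haK hV) (by positivity)
      _ ≤ _ := le_mul_of_one_le_right (by positivity) (by linarith)
  have h3 : κ * (a * L) * ((a * L) * (1 + T)) ≤ D * ((a * L) * (1 + T)) := by
    rw [hD]
    linarith
  have h4 : κ * (a * L) ≤ D := le_of_mul_le_mul_right h3 (by positivity)
  have h5 : a * L ≤ D / κ := by
    rw [le_div_iff₀ hκ]; linarith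
  linarith

/-- The algebra of the maximum principle. Here `a = -u`, `p = Du`, `L` is the largest eigenvalue
`lam i` of the Hessian, `r` and `Q` are the first and second derivatives of `u_ξξ` in the top
direction `ξ`, and `t k i = u_{kii}`. Uniform ellipticity makes `∑ dᵢ λᵢ²` control
`(1 + ∑ dᵢ) L²`, which beats all other terms once `a L` is large. -/
lemma exists_bound_of_inequalities (n : ℕ) {K M c A m₀ C₁ C₂ C₃ : ℝ} (hK : 0 ≤ K)
    (hc : 0 < c) (hA : 0 < A) (hAK : 4 * (A * K ^ 2) ≤ 1) (hm₀ : 0 ≤ m₀) (hM : 0 ≤ M)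
    (hC₁ : 0 ≤ C₁) (hC₂ : 0 ≤ C₂) (hC₃ : 0 ≤ C₃) :
    ∃ C : ℝ, ∀ (a L : ℝ) (lam d p r Q : Fin n → ℝ) (t : Fin n → Fin n → ℝ) (i₀ : Fin n),
      0 < a → a ≤ K → 1 ≤ L → lam i₀ = L → (∀ i, |lam i| ≤ M * L) → (∀ i, |p i| ≤ K) →
      (∀ i, 0 ≤ d i) → (∀ i, c * (1 + ∑ j, d j) ≤ d i) → ∑ i, d i * lam i ≤ m₀ →
      (∀ i, -(p i / a) + r i / L + A * (p i * lam i) = 0) →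
      (∀ i, -(lam i / a) - (p i / a) ^ 2 + Q i / L - (r i / L) ^ 2 +
        A * (lam i ^ 2 + ∑ k, p k * t k i) ≤ 0) →
      (∀ k, |∑ i, d i * t k i| ≤ C₁ * L) →
      -(C₂ * L ^ 2 + C₃ * ∑ k, |r k|) ≤ ∑ i, d i * Q i →
      a * L ≤ C := by
  refine ⟨1 + ((m₀ + C₃ * (n * K)) * K + 3 * K ^ 2 +
    (C₂ + C₃ * (n * (A * (K * M))) + A * (n * (K * C₁))) * K) / (A * c / 2), ?_⟩
  intro a L lam d p r Q t i₀ ha haK hL hi₀ hlam hp hd hell hm0 hP1 hP2 hH1 hH2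
  have hL0 : 0 < L := by linarith
  set T := ∑ j, d j with hT
  have hT0 : 0 ≤ T := Finset.sum_nonneg fun i _ => hd i
  have hr : ∀ i, r i / L = p i / a - A * (p i * lam i) := fun i => by linarith [hP1 i]
  have hp2 : ∀ i, p i ^ 2 ≤ K ^ 2 := fun i => sq_le_sq' (by linarith [neg_abs_le (p i), hp i])
    ((le_abs_self _).trans (hp i))
  -- The gradient terms are absorbed with the choice of `A`.
  have hgrad : ∀ i, (p i / a) ^ 2 + (r i / L) ^ 2 ≤ 3 * K ^ 2 / a ^ 2 + A / 2 * lam i ^ 2 := by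
    intro i
    rw [hr i]
    have h1 : (p i / a) ^ 2 ≤ K ^ 2 / a ^ 2 := by
      rw [div_pow]; exact div_le_div_of_nonneg_right (hp2 i) (by positivity)
    have h2 : (p i / a - A * (p i * lam i)) ^ 2 ≤
        2 * (p i / a) ^ 2 + 2 * (A * (p i * lam i)) ^ 2 := by
      nlinarith [sq_nonneg (p i / a + A * (p i * lam i))]
    have h3 : 2 * (A * (p i * lam i)) ^ 2 ≤ A / 2 * lam i ^ 2 := by
      have h4 : A * p i ^ 2 * 4 ≤ 1 := by nlinarith [hp2 i]
      have : 0 ≤ A / 2 * lam i ^ 2 := by positivity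
      calc 2 * (A * (p i * lam i)) ^ 2 = (A / 2 * lam i ^ 2) * (A * p i ^ 2 * 4) := by ring
        _ ≤ (A / 2 * lam i ^ 2) * 1 := by gcongr
        _ = _ := mul_one _
    have h5 : 3 * K ^ 2 / a ^ 2 = 3 * (K ^ 2 / a ^ 2) := by ring
    linarith
  have hsum : ∑ i, d i * (-(lam i / a) + Q i / L + A / 2 * lam i ^ 2 + A * ∑ k, p k * t k i -
      3 * K ^ 2 / a ^ 2) ≤ 0 := by
    refine Finset.sum_nonpos fun i _ => mul_nonpos_of_nonneg_of_nonpos (hd i) ?_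
    linarith [hP2 i, hgrad i]
  have hsplit : ∑ i, d i * (-(lam i / a) + Q i / L + A / 2 * lam i ^ 2 + A * ∑ k, p k * t k i -
      3 * K ^ 2 / a ^ 2) = -((∑ i, d i * lam i) / a) + (∑ i, d i * Q i) / L +
      A / 2 * ∑ i, d i * lam i ^ 2 + A * ∑ k, p k * ∑ i, d i * t k i - T * (3 * K ^ 2 / a ^ 2) := by
    have e1 : ∑ k, p k * ∑ i, d i * t k i = ∑ i, d i * ∑ k, p k * t k i := by
      simp_rw [Finset.mul_sum]
      rw [Finset.sum_comm]
      exact Finset.sum_congr rfl fun i _ => Finset.sum_congr rfl fun k _ => by ring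
    rw [e1, hT, Finset.sum_div, Finset.sum_div, Finset.mul_sum, Finset.mul_sum, Finset.sum_mul,
      ← Finset.sum_neg_distrib, ← Finset.sum_add_distrib, ← Finset.sum_add_distrib,
      ← Finset.sum_add_distrib, ← Finset.sum_sub_distrib]
    exact Finset.sum_congr rfl fun i _ => by ring
  rw [hsplit] at hsum
  have b1 : (∑ i, d i * lam i) / a ≤ m₀ / a := div_le_div_of_nonneg_right hm0 ha.le
  have b2 : c * (1 + T) * L ^ 2 ≤ ∑ i, d i * lam i ^ 2 := by
    calc c * (1 + T) * L ^ 2 ≤ d i₀ * lam i₀ ^ 2 := by rw [hi₀]; gcongr; exact hell i₀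
      _ ≤ _ := Finset.single_le_sum (f := fun i => d i * lam i ^ 2)
        (fun i _ => mul_nonneg (hd i) (sq_nonneg _)) (Finset.mem_univ i₀)
  have b3 : |∑ k, p k * ∑ i, d i * t k i| ≤ n * (K * C₁) * L := by
    calc _ ≤ ∑ k, |p k * ∑ i, d i * t k i| := Finset.abs_sum_le_sum_abs _ _
      _ ≤ ∑ k : Fin n, K * (C₁ * L) := Finset.sum_le_sum fun k _ => by
          rw [abs_mul]; gcongr; exacts [hp k, hH1 k]
      _ = _ := by simp; ring
  have b4 : (∑ k, |r k|) / L ≤ n * (K / a + A * (K * M) * L) := by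
    rw [Finset.sum_div]
    calc ∑ k, |r k| / L ≤ ∑ k : Fin n, (K / a + A * (K * M) * L) :=
          Finset.sum_le_sum fun k _ => by
            have h1 : |r k| / L = |p k / a - A * (p k * lam k)| := by
              rw [← hr k, abs_div, abs_of_pos hL0]
            rw [h1]
            refine (abs_sub _ _).trans ?_
            rw [abs_div, abs_of_pos ha, abs_mul, abs_of_pos hA, abs_mul]
            have h2 : |p k| * |lam k| ≤ K * (M * L) := by
              gcongr
              exacts [hp k, hlam k]
            have h3 : |p k| / a ≤ K / a := div_le_div_of_nonneg_right (hp k) ha.le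
            nlinarith
      _ = _ := by simp; ring
  have b5 : -(C₂ * L + C₃ * (n * (K / a + A * (K * M) * L))) ≤ (∑ i, d i * Q i) / L := by
    calc _ ≤ -(C₂ * L + C₃ * ((∑ k, |r k|) / L)) := by gcongr
      _ = -(C₂ * L ^ 2 + C₃ * ∑ k, |r k|) / L := by field_simp
      _ ≤ _ := div_le_div_of_nonneg_right hH2 hL0.le
  have main : A / 2 * (c * (1 + T) * L ^ 2) ≤ (m₀ + C₃ * (n * K)) / a + T * (3 * K ^ 2 / a ^ 2) +
      (C₂ + C₃ * (n * (A * (K * M))) + A * (n * (K * C₁))) * L := by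
    have h1 : A / 2 * (c * (1 + T) * L ^ 2) ≤ A / 2 * ∑ i, d i * lam i ^ 2 := by gcongr
    have h2 : -(A * (n * (K * C₁) * L)) ≤ A * ∑ k, p k * ∑ i, d i * t k i := by
      rw [← mul_neg]
      exact mul_le_mul_of_nonneg_left (neg_le_of_abs_le b3) hA.le
    have h3 : (m₀ + C₃ * (n * K)) / a = m₀ / a + C₃ * (n * (K / a)) := by ring
    rw [h3]
    linarith
  have main2 : A * c / 2 * (L ^ 2 * (1 + T)) ≤ (m₀ + C₃ * (n * K)) / a + T * (3 * K ^ 2 / a ^ 2) +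
      (C₂ + C₃ * (n * (A * (K * M))) + A * (n * (K * C₁))) * L := by
    refine le_trans (le_of_eq ?_) main
    ring
  exact mul_le_of_quadratic_le ha haK hL0 (by positivity) (by positivity) (by positivity) hT0 main2

end PointwiseEstimate

/-! ### The estimate at an interior maximum -/

section InteriorMaximum

open Filter Topology
open scoped InnerProductSpace

variable {n : ℕ}

/-- The estimate at an interior point where the Pogorelov function
`log (-u) + log u_ξξ + (A/2) |Du|²` has a local maximum, `ξ = b i₀` being an eigenvector for the
largest eigenvalue of the Hessian. The equation enters only through the fact that the linearization
`∑ᵢ dᵢ u_ii` touches `log f(x, u, Du)` from above. -/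
lemma exists_bound_at_isLocalMax (n : ℕ) {K M c m₀ m N : ℝ} (hK : 0 ≤ K) (hc : 0 < c)
    (hm₀ : 0 ≤ m₀) (hM : 0 ≤ M) (hm : 0 < m) (hN : 0 ≤ N) :
    ∃ C : ℝ, ∀ (Ω : Set (EuclideanSpace ℝ (Fin n))) (x : EuclideanSpace ℝ (Fin n))
      (u : EuclideanSpace ℝ (Fin n) → ℝ)
      (f : EuclideanSpace ℝ (Fin n) × ℝ × EuclideanSpace ℝ (Fin n) → ℝ)
      (b : OrthonormalBasis (Fin n) ℝ (EuclideanSpace ℝ (Fin n))) (lam d : Fin n → ℝ) (i₀ : Fin n)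
      (Y : EuclideanSpace ℝ (Fin n) → EuclideanSpace ℝ (Fin n) × ℝ × EuclideanSpace ℝ (Fin n)),
      IsOpen Ω → x ∈ Ω → ContDiffOn ℝ 4 u Ω → ContDiffOn ℝ 2 f (Ω ×ˢ univ) →
      u x < 0 → -u x ≤ K → ‖fderiv ℝ u x‖ ≤ K →
      (∀ i v, fderiv ℝ (fderiv ℝ u) x v (b i) = lam i * ⟪b i, v⟫_ℝ) →
      1 ≤ lam i₀ → (∀ i, |lam i| ≤ M * lam i₀) →
      (∀ i, 0 ≤ d i) → (∀ i, c * (1 + ∑ j, d j) ≤ d i) → ∑ i, d i * lam i ≤ m₀ →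
      Y = (fun y => (y, u y, ∑ k, dirDeriv (b k) u y • b k)) →
      m ≤ f (Y x) → ‖fderiv ℝ f (Y x)‖ ≤ N → ‖fderiv ℝ (fderiv ℝ f) (Y x)‖ ≤ N →
      IsLocalMax (fun y => Real.log (-u y) + Real.log (dirDeriv (b i₀) (dirDeriv (b i₀) u) y) +
        (4 * K ^ 2 + 1)⁻¹ / 2 * ∑ k, dirDeriv (b k) u y ^ 2) x →
      IsLocalMax (fun y => Real.log (f (Y y)) -
        ∑ i, d i * dirDeriv (b i) (dirDeriv (b i) u) y) x →
      -u x * lam i₀ ≤ C := by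
  set A : ℝ := (4 * K ^ 2 + 1)⁻¹ with hA
  have hA0 : 0 < A := by positivity
  have hAK : 4 * (A * K ^ 2) ≤ 1 := by
    rw [hA]
    have : (4 * K ^ 2 + 1)⁻¹ * (4 * K ^ 2 + 1) = 1 := inv_mul_cancel₀ (by positivity)
    have h2 : 0 < (4 * K ^ 2 + 1)⁻¹ := by positivity
    linarith
  set R := 1 + K + M with hR
  have hR0 : 0 ≤ R := by positivity
  obtain ⟨C, hC⟩ := exists_bound_of_inequalities n (C₁ := N / m * R)
    (C₂ := (N * R ^ 2 + N) / m + (N / m * R) ^ 2) (C₃ := N / m) hK hc hA0 hAK hm₀ hM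
    (by positivity) (by positivity) (by positivity)
  refine ⟨C, ?_⟩
  intro Ω x u f b lam d i₀ Y hΩ hx hu hf hux huK hDu hB hL hlam hd hell hm0 hY hfm hf1 hf2 hP hH
  set L := lam i₀ with hLdef
  have hL0 : 0 < L := by linarith
  -- Regularity and symmetry of the derivatives of `u`.
  have hu2 : ContDiffOn ℝ 2 u Ω := hu.of_le (by norm_num)
  have hg : ∀ v, ContDiffOn ℝ 3 (dirDeriv v u) Ω := fun v => ContDiffOn.dirDeriv (m := 3) hΩ hu v
  have hg2 : ∀ v, ContDiffOn ℝ 2 (dirDeriv v u) Ω := fun v => (hg v).of_le (by norm_num)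
  have hq : ∀ v w, ContDiffOn ℝ 2 (dirDeriv v (dirDeriv w u)) Ω := fun v w =>
    ContDiffOn.dirDeriv (m := 2) hΩ (hg w) v
  have hq1 : ∀ v w z, EqOn (dirDeriv v (dirDeriv w (dirDeriv z u)))
      (dirDeriv w (dirDeriv v (dirDeriv z u))) Ω := fun v w z => dirDeriv_comm hΩ (hg2 z) v w
  have hq2 : ∀ v w z, EqOn (dirDeriv v (dirDeriv w (dirDeriv z u)))
      (dirDeriv v (dirDeriv z (dirDeriv w u))) Ω := fun v w z =>
    (dirDeriv_comm hΩ hu2 w z).dirDeriv hΩ v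
  have hhess : ∀ v i, dirDeriv v (dirDeriv (b i) u) x = lam i * ⟪b i, v⟫_ℝ := fun v i => by
    rw [dirDeriv_dirDeriv hΩ hu2 hx, hB]
  have hbb : ∀ i j, ⟪b i, b j⟫_ℝ = if i = j then 1 else 0 := fun i j =>
    orthonormal_iff_ite.mp b.orthonormal i j
  set w := dirDeriv (b i₀) (dirDeriv (b i₀) u) with hw
  have hwx : w x = L := by rw [hw, hhess, hbb]; simp [hLdef]
  have third : ∀ i k, dirDeriv (b i) (dirDeriv (b i) (dirDeriv (b k) u)) x =
      dirDeriv (b k) (dirDeriv (b i) (dirDeriv (b i) u)) x := fun i k => by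
    rw [hq2 (b i) (b i) (b k) hx, hq1 (b i) (b k) (b i) hx]
  have fourth : ∀ i, dirDeriv (b i) (dirDeriv (b i) w) x =
      dirDeriv (b i₀) (dirDeriv (b i₀) (dirDeriv (b i) (dirDeriv (b i) u))) x := by
    intro i
    set ξ := b i₀
    set e := b i
    have s1 : EqOn (dirDeriv e w) (dirDeriv ξ (dirDeriv ξ (dirDeriv e u))) Ω := fun y hy => by
      rw [hw, hq1 e ξ ξ hy, hq2 ξ e ξ hy]
    rw [s1.dirDeriv hΩ e hx]
    rw [dirDeriv_comm hΩ (ContDiffOn.dirDeriv (m := 2) hΩ (hg e) ξ) e ξ hx]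
    exact Set.EqOn.dirDeriv hΩ (hq1 e ξ e) ξ hx
  -- The conditions at the two maxima.
  have hfpos : 0 < f (Y x) := by linarith
  have condP := fun i => conditions_of_isLocalMax_log hΩ hx hu2 (hq (b i₀) (b i₀))
    (fun k => hg2 (b k)) hux (by rw [← hw, hwx]; exact hL0) A hP (b i)
  have condH := fun v => conditions_of_isLocalMax_comp hΩ hx hu2 (fun k => hg2 (b k))
    (fun i => hq (b i) (b i)) (fun k => b k) d hf hY hfpos hH v rfl rfl
  have hp : ∀ i, |dirDeriv (b i) u x| ≤ K := fun i => by
    calc |fderiv ℝ u x (b i)| ≤ ‖fderiv ℝ u x‖ * ‖b i‖ := (fderiv ℝ u x).le_opNorm _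
      _ ≤ K := by rw [b.orthonormal.1 i, mul_one]; exact hDu
  have hsum1 : ∀ i, ∑ k, dirDeriv (b i) (dirDeriv (b k) u) x • b k = lam i • b i := by
    intro i
    simp_rw [hhess, hbb]
    simp
  have hY1 : ∀ i, ‖((b i, dirDeriv (b i) u x, ∑ k, dirDeriv (b i) (dirDeriv (b k) u) x • b k) :
      EuclideanSpace ℝ (Fin n) × ℝ × EuclideanSpace ℝ (Fin n))‖ ≤ R * L := by
    intro i
    rw [hsum1, Prod.norm_mk, Prod.norm_mk, norm_smul, b.orthonormal.1 i, Real.norm_eq_abs,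
      Real.norm_eq_abs, mul_one]
    have h1 : 1 * 1 ≤ R * L := by gcongr; linarith
    have h2 : K * 1 ≤ R * L := by gcongr; linarith
    have h3 : M * L ≤ R * L := by gcongr; linarith
    exact max_le (by linarith) (max_le ((hp i).trans (by linarith)) ((hlam i).trans h3))
  have hY2 : ‖((0, dirDeriv (b i₀) (dirDeriv (b i₀) u) x,
      ∑ k, dirDeriv (b i₀) (dirDeriv (b i₀) (dirDeriv (b k) u)) x • b k) :
      EuclideanSpace ℝ (Fin n) × ℝ × EuclideanSpace ℝ (Fin n))‖ ≤
      L + ∑ k, |dirDeriv (b k) w x| := by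
    rw [Prod.norm_mk, Prod.norm_mk, norm_zero, ← hw, hwx, Real.norm_eq_abs, abs_of_pos hL0]
    have h0 : 0 ≤ ∑ k, |dirDeriv (b k) w x| := Finset.sum_nonneg fun k _ => abs_nonneg _
    refine max_le (by linarith) (max_le (by linarith) ?_)
    refine le_trans (norm_sum_le _ _) ?_
    have : ∀ k, ‖dirDeriv (b i₀) (dirDeriv (b i₀) (dirDeriv (b k) u)) x • b k‖ =
        |dirDeriv (b k) w x| := fun k => by
      rw [norm_smul, b.orthonormal.1 k, mul_one, Real.norm_eq_abs, third]
    simp_rw [this]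
    linarith
  have hdf : ∀ Z, |fderiv ℝ f (Y x) Z| ≤ N * ‖Z‖ := fun Z =>
    ((fderiv ℝ f (Y x)).le_opNorm Z).trans (by gcongr)
  have hddf : ∀ Z, |fderiv ℝ (fderiv ℝ f) (Y x) Z Z| ≤ N * ‖Z‖ ^ 2 := fun Z => by
    refine ((fderiv ℝ (fderiv ℝ f) (Y x)).le_opNorm₂ Z Z).trans ?_
    rw [mul_assoc, ← sq]
    gcongr
  have hquot : ∀ i, |∑ j, d j * dirDeriv (b i) (dirDeriv (b j) (dirDeriv (b j) u)) x| ≤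
      N / m * R * L := by
    intro i
    rw [(condH (b i)).1, abs_div, abs_of_pos hfpos]
    calc _ ≤ N * (R * L) / m := by
          gcongr
          exact (hdf _).trans (by gcongr; exact hY1 i)
      _ = _ := by ring
  refine hC (-u x) L lam d (fun i => dirDeriv (b i) u x) (fun i => dirDeriv (b i) w x)
    (fun i => dirDeriv (b i) (dirDeriv (b i) w) x)
    (fun k i => dirDeriv (b k) (dirDeriv (b i) (dirDeriv (b i) u)) x) i₀
    (by linarith) huK hL rfl hlam hp hd hell hm0 ?_ ?_ hquot ?_
  · intro i
    have h := (condP i).1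
    rw [← hw, hwx] at h
    have e : ∑ k, dirDeriv (b k) u x * dirDeriv (b i) (dirDeriv (b k) u) x =
        dirDeriv (b i) u x * lam i := by
      simp_rw [hhess, hbb]
      simp
    rw [e] at h
    rw [div_neg, neg_neg]
    exact h
  · intro i
    have h := (condP i).2
    rw [← hw, hwx, hhess, hbb, if_pos rfl, mul_one, Finset.sum_add_distrib] at h
    have e : ∑ k, dirDeriv (b i) (dirDeriv (b k) u) x ^ 2 = lam i ^ 2 := by
      simp_rw [hhess, hbb]
      simp
    have e2 : ∑ k, dirDeriv (b k) u x * dirDeriv (b i) (dirDeriv (b i) (dirDeriv (b k) u)) x =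
        ∑ k, dirDeriv (b k) u x * dirDeriv (b k) (dirDeriv (b i) (dirDeriv (b i) u)) x :=
      Finset.sum_congr rfl fun k _ => by rw [third]
    rw [e, e2] at h
    rw [div_neg, neg_neg, div_neg, neg_sq]
    exact h
  · have h := (condH (b i₀)).2
    have hq' := hquot i₀
    rw [(condH (b i₀)).1] at hq'
    simp_rw [fourth]
    refine le_trans ?_ h
    have h1 := (abs_le.mp ((hddf (b i₀, dirDeriv (b i₀) u x,
      ∑ k, dirDeriv (b i₀) (dirDeriv (b k) u) x • b k)).trans
      (mul_le_mul_of_nonneg_left (pow_le_pow_left₀ (norm_nonneg _) (hY1 i₀) 2) hN))).1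
    have h2 := (abs_le.mp ((hdf _).trans (mul_le_mul_of_nonneg_left hY2 hN))).1
    set s := ∑ k, |dirDeriv (b k) w x|
    have hs0 : 0 ≤ s := Finset.sum_nonneg fun k _ => abs_nonneg _
    have h3 := sq_le_sq' (abs_le.mp hq').1 (abs_le.mp hq').2
    have h4 : -((N * (R * L) ^ 2 + N * (L + s)) / m) ≤
        (fderiv ℝ (fderiv ℝ f) (Y x) (b i₀, dirDeriv (b i₀) u x,
          ∑ k, dirDeriv (b i₀) (dirDeriv (b k) u) x • b k) (b i₀, dirDeriv (b i₀) u x,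
          ∑ k, dirDeriv (b i₀) (dirDeriv (b k) u) x • b k) +
        fderiv ℝ f (Y x) (0, dirDeriv (b i₀) (dirDeriv (b i₀) u) x,
          ∑ k, dirDeriv (b i₀) (dirDeriv (b i₀) (dirDeriv (b k) u)) x • b k)) / f (Y x) := by
      have hnn : 0 ≤ N * (R * L) ^ 2 + N * (L + s) := by positivity
      have h5 : (N * (R * L) ^ 2 + N * (L + s)) / f (Y x) ≤
          (N * (R * L) ^ 2 + N * (L + s)) / m := by gcongr
      refine le_trans (neg_le_neg h5) ?_
      rw [← neg_div]
      gcongr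
      linarith
    have h6 : -(((N * R ^ 2 + N) / m + (N / m * R) ^ 2) * L ^ 2 + N / m * s) ≤
        -((N * (R * L) ^ 2 + N * (L + s)) / m) - (N / m * R * L) ^ 2 := by
      have h7 : N / m * L ≤ N / m * L ^ 2 := by
        gcongr
        nlinarith
      have e1 : (N * (R * L) ^ 2 + N * (L + s)) / m =
        N * R ^ 2 / m * L ^ 2 + N / m * L + N / m * s := by ring
      have e2 : ((N * R ^ 2 + N) / m + (N / m * R) ^ 2) * L ^ 2 =
        N * R ^ 2 / m * L ^ 2 + N / m * L ^ 2 + (N / m * R * L) ^ 2 := by ring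
      rw [e1, e2]
      linarith
    linarith

end InteriorMaximum

/-! ### Consequences of the equation -/

section Equation

open Filter Topology
open scoped InnerProductSpace

variable {n : ℕ}

lemma norm_iteratedFDeriv_le_of_cNorm_le {V : Type*} [NormedAddCommGroup V] [NormedSpace ℝ V]
    {j i : ℕ} {g : V → ℝ} {U : Set V} {B : ℝ≥0} (h : cNorm j g U ≤ B) (hi : i ≤ j) {x : V}
    (hx : x ∈ U) : ‖iteratedFDeriv ℝ i g x‖ ≤ B := by
  have h1 : ‖iteratedFDeriv ℝ i g x‖ₑ ≤ B := by
    refine le_trans ?_ h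
    refine le_trans ?_ (Finset.single_le_sum (f := fun i => ⨆ x ∈ U, ‖iteratedFDeriv ℝ i g x‖ₑ)
      (fun _ _ => zero_le) (Finset.mem_range.mpr (Nat.lt_succ_of_le hi)))
    exact le_iSup₂ (f := fun x _ => ‖iteratedFDeriv ℝ i g x‖ₑ) x hx
  rw [← enorm_norm, Real.enorm_eq_ofReal (norm_nonneg _)] at h1
  exact (ENNReal.ofReal_le_coe).mp h1 |>.trans (by simp)

lemma norm_iteratedFDeriv_two {V : Type*} [NormedAddCommGroup V] [NormedSpace ℝ V]
    (g : V → ℝ) (x : V) : ‖iteratedFDeriv ℝ 2 g x‖ = ‖fderiv ℝ (fderiv ℝ g) x‖ := by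
  rw [← norm_iteratedFDeriv_one, norm_iteratedFDeriv_fderiv]

lemma gradient_eq_sum (b : OrthonormalBasis (Fin n) ℝ (EuclideanSpace ℝ (Fin n)))
    (u : EuclideanSpace ℝ (Fin n) → ℝ) (x : EuclideanSpace ℝ (Fin n)) :
    gradient u x = ∑ k, dirDeriv (b k) u x • b k := by
  conv_lhs => rw [← b.sum_repr' (gradient u x)]
  refine Finset.sum_congr rfl fun k _ => ?_
  rw [real_inner_comm, gradient, InnerProductSpace.toDual_symm_apply]
  rfl

lemma norm_gradient (u : EuclideanSpace ℝ (Fin n) → ℝ) (x : EuclideanSpace ℝ (Fin n)) :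
    ‖gradient u x‖ = ‖fderiv ℝ u x‖ := by
  rw [gradient, LinearIsometryEquiv.norm_map]

lemma sum_sq_dirDeriv (b : OrthonormalBasis (Fin n) ℝ (EuclideanSpace ℝ (Fin n)))
    (u : EuclideanSpace ℝ (Fin n) → ℝ) (x : EuclideanSpace ℝ (Fin n)) :
    ∑ k, dirDeriv (b k) u x ^ 2 = ‖fderiv ℝ u x‖ ^ 2 := by
  rw [← norm_gradient, ← b.sum_sq_norm_inner_right (gradient u x)]
  refine Finset.sum_congr rfl fun k _ => ?_
  rw [real_inner_comm, gradient, InnerProductSpace.toDual_symm_apply, Real.norm_eq_abs, sq_abs]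
  rfl

/-- `(η, α)` lies in the cone `Γ_k` of `ℝ^{n+1}`: this is where the extra variable `α` turns the sum
Hessian operator into an ordinary Hessian quotient, and `(k-1)`-admissibility together with the
positivity of the right-hand side into `k`-admissibility. -/
lemma inGardingCone_etaAlpha {k l : ℕ} (hlk : l < k) {α : ℝ} (hα : 0 ≤ α)
    {Ω : Set (EuclideanSpace ℝ (Fin n))}
    {f : EuclideanSpace ℝ (Fin n) × ℝ × EuclideanSpace ℝ (Fin n) → ℝ}
    {u : EuclideanSpace ℝ (Fin n) → ℝ} (hadm : IsAdmissible (k - 1) u Ω)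
    (hsol : SolvesSumHessianQuotient k l α f u Ω) {x : EuclideanSpace ℝ (Fin n)} (hx : x ∈ Ω)
    (hf : 0 < f (x, u x, gradient u x)) {lam : Fin n → ℝ}
    (heta : etaEigenvalues u x = Finset.univ.val.map fun i => ∑ j, lam j - lam i) :
    InGardingCone Finset.univ k (etaAlpha α lam) ∧
      sumQuotient k l α lam = f (x, u x, gradient u x) := by
  have hs := hsol x hx
  have he : ∀ j, sumHessian α j (etaEigenvalues u x) = esym Finset.univ (etaAlpha α lam) j :=
    fun j => by rw [heta, sumHessian_eq_esym]
  rw [he, he] at hs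
  have hlow : ∀ j < k, 0 < esym Finset.univ (etaAlpha α lam) j := by
    intro j hj
    rw [← he]
    cases j with
    | zero => rw [he, esym_zero]; exact one_pos
    | succ j =>
      have h1 := hadm x hx (j + 1) (by omega) (by omega)
      have h2 : 0 ≤ (etaEigenvalues u x).esymm j := by
        rcases Nat.eq_zero_or_pos j with rfl | h
        · rw [heta, multiset_esymm_map, esym_zero]; exact zero_le_one
        · exact (hadm x hx j h (by omega)).le
      rw [sumHessian]
      positivity
  refine ⟨fun j hj => ?_, hs⟩
  rcases hj.lt_or_eq with h | rfl
  · exact hlow j h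
  · have h1 := hlow l hlk
    rw [← hs] at hf
    exact (div_pos_iff_of_pos_right h1).mp hf

lemma esym_one_etaAlpha (α : ℝ) (lam : Fin n → ℝ) :
    esym Finset.univ (etaAlpha α lam) 1 = α + ((n : ℝ) - 1) * ∑ i, lam i := by
  rw [esym_one, Fintype.sum_option]
  simp [etaAlpha, Finset.sum_sub_distrib]
  ring

end Equation

/-! ### The global estimate -/

section Pogorelov

open Filter Topology
open scoped InnerProductSpace

variable {n : ℕ}

/-- The linearization of the equation at `x` touches `log f(x, u, Du)` from above. -/
lemma isLocalMax_log_sub_linearization {k l : ℕ} (hlk : l < k) {α : ℝ} (hα : 0 ≤ α)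
    {Ω : Set (EuclideanSpace ℝ (Fin n))} (hΩ : IsOpen Ω)
    {f : EuclideanSpace ℝ (Fin n) × ℝ × EuclideanSpace ℝ (Fin n) → ℝ}
    {u : EuclideanSpace ℝ (Fin n) → ℝ} (hu : ContDiffOn ℝ 2 u Ω)
    (hadm : IsAdmissible (k - 1) u Ω) (hsol : SolvesSumHessianQuotient k l α f u Ω)
    (hf : ∀ y ∈ Ω, 0 < f (y, u y, gradient u y)) {x : EuclideanSpace ℝ (Fin n)} (hx : x ∈ Ω)
    {b : OrthonormalBasis (Fin n) ℝ (EuclideanSpace ℝ (Fin n))} {lam d : Fin n → ℝ}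
    (hB : ∀ i v, fderiv ℝ (fderiv ℝ u) x v (b i) = lam i * ⟪b i, v⟫_ℝ)
    (hlam : sumQuotient k l α lam = f (x, u x, gradient u x))
    (hd : ∀ (μ : Fin n → ℝ) (S : Matrix (Fin n) (Fin n) ℝ), S ∈ doublyStochastic ℝ (Fin n) →
      InGardingCone Finset.univ k (etaAlpha α μ) →
      Real.log (sumQuotient k l α μ) - Real.log (sumQuotient k l α lam) ≤
        ∑ i, d i * (∑ j, S i j * μ j - lam i)) :
    IsLocalMax (fun y => Real.log (f (y, u y, ∑ k, dirDeriv (b k) u y • b k)) -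
      ∑ i, d i * dirDeriv (b i) (dirDeriv (b i) u) y) x := by
  filter_upwards [hΩ.mem_nhds hx] with y hy
  obtain ⟨c, μ, hc, hμ⟩ := exists_hessian_eigenbasis u y (fderiv_fderiv_comm hΩ hu hy)
  obtain ⟨hG, hQ⟩ := inGardingCone_etaAlpha hlk hα hadm hsol hy (hf y hy) hμ
  obtain ⟨S, hS, hSd⟩ := exists_doublyStochastic b hc
  have key := hd μ S hS hG
  rw [hQ, hlam] at key
  have e1 : ∀ i, dirDeriv (b i) (dirDeriv (b i) u) y = ∑ j, S i j * μ j := fun i => by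
    rw [dirDeriv_dirDeriv hΩ hu hy, hSd]
  have e2 : ∀ i, dirDeriv (b i) (dirDeriv (b i) u) x = lam i := fun i => by
    rw [dirDeriv_dirDeriv hΩ hu hx, hB, real_inner_self_eq_norm_sq, b.orthonormal.1 i]
    ring
  simp_rw [e1, e2, ← gradient_eq_sum]
  simp_rw [mul_sub, Finset.sum_sub_distrib] at key
  linarith

/-- A continuous function on the closure of a bounded set `Ω`, zero on the boundary and negative
somewhere in `Ω`, has a negative minimum, attained in `Ω`. -/
lemma exists_isMinOn_of_neg {Ω : Set (EuclideanSpace ℝ (Fin n))}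
    (hΩ : IsOpen Ω) (hb : Bornology.IsBounded Ω) {u : EuclideanSpace ℝ (Fin n) → ℝ}
    (hu : ContinuousOn u (closure Ω)) (h0 : ∀ x ∈ frontier Ω, u x = 0)
    {x : EuclideanSpace ℝ (Fin n)} (hx : x ∈ Ω) (hux : u x < 0) :
    ∃ y ∈ Ω, u y < 0 ∧ ∀ z ∈ Ω, u y ≤ u z := by
  obtain ⟨y, hy, hmin⟩ := hb.isCompact_closure.exists_isMinOn ⟨x, subset_closure hx⟩ hu
  have hyx : u y < 0 := (hmin (subset_closure hx)).trans_lt hux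
  refine ⟨y, ?_, hyx, fun z hz => hmin (subset_closure hz)⟩
  by_contra hcon
  have : y ∈ frontier Ω := ⟨hy, by rwa [hΩ.interior_eq]⟩
  linarith [h0 y this]

/-- A lower bound for the Laplacian. For `k ≥ 2` it is part of admissibility. For `k = 1` the equation
reads `(n-1) Δu + α = f`, and at a minimum of `u` it shows that `α ≤ sup f`. -/
lemma neg_le_sum_eigenvalues {k l : ℕ} (hlk : l < k) (hkn : k < n) {α : ℝ} (hα : 0 ≤ α)
    {Ω : Set (EuclideanSpace ℝ (Fin n))} (hΩ : IsOpen Ω) (hb : Bornology.IsBounded Ω)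
    {f : EuclideanSpace ℝ (Fin n) × ℝ × EuclideanSpace ℝ (Fin n) → ℝ}
    {u : EuclideanSpace ℝ (Fin n) → ℝ} (hu : ContDiffOn ℝ 2 u Ω) (huc : ContinuousOn u (closure Ω))
    (hadm : IsAdmissible (k - 1) u Ω) (hsol : SolvesSumHessianQuotient k l α f u Ω)
    (h0 : ∀ x ∈ frontier Ω, u x = 0) {N : ℝ}
    (hf : ∀ y ∈ Ω, 0 < f (y, u y, gradient u y)) (hfN : ∀ y ∈ Ω, f (y, u y, gradient u y) ≤ N)
    (hneg : ∃ y ∈ Ω, u y < 0) {x : EuclideanSpace ℝ (Fin n)} (hx : x ∈ Ω) {lam : Fin n → ℝ}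
    (heta : etaEigenvalues u x = Finset.univ.val.map fun i => ∑ j, lam j - lam i) :
    -N ≤ ∑ i, lam i := by
  have hN : 0 < N := (hf x hx).trans_le (hfN x hx)
  have hn : (1 : ℝ) ≤ (n : ℝ) - 1 := by
    have : (2 : ℝ) ≤ n := by exact_mod_cast (by omega : 2 ≤ n)
    linarith
  suffices h : -N ≤ ((n : ℝ) - 1) * ∑ i, lam i by
    by_contra hcon
    push Not at hcon
    nlinarith
  rcases Nat.lt_or_ge 1 k with hk | hk
  · have h1 := hadm x hx 1 le_rfl (by omega)
    rw [heta, multiset_esymm_map, esym_one, Finset.sum_sub_distrib] at h1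
    simp only [Finset.sum_const, Finset.card_univ, Fintype.card_fin, nsmul_eq_mul] at h1
    linarith
  · obtain rfl : k = 1 := by omega
    obtain rfl : l = 0 := by omega
    have equation : ∀ y ∈ Ω, ∀ μ : Fin n → ℝ,
        (etaEigenvalues u y = Finset.univ.val.map fun i => ∑ j, μ j - μ i) →
        α + ((n : ℝ) - 1) * ∑ i, μ i = f (y, u y, gradient u y) := by
      intro y hy μ hμ
      rw [← (inGardingCone_etaAlpha hlk hα hadm hsol hy (hf y hy) hμ).2, sumQuotient, esym_zero,
        esym_one_etaAlpha, div_one]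
    obtain ⟨z, hz, huz⟩ := hneg
    obtain ⟨y, hy, -, hmin⟩ := exists_isMinOn_of_neg hΩ hb huc h0 hz huz
    obtain ⟨c, μ, hc, hμ⟩ := exists_hessian_eigenbasis u y (fderiv_fderiv_comm hΩ hu hy)
    have hpos : ∀ i, 0 ≤ μ i := by
      intro i
      have hmax : IsLocalMax (fun p => -u p) y := by
        filter_upwards [hΩ.mem_nhds hy] with p hp using neg_le_neg (hmin p hp)
      obtain ⟨d1, d2⟩ := hasDerivAt_dirDeriv_line hΩ hu hy (c i)
      have := (IsLocalMax.hasDerivAt_eq_zero_and_nonpos (hmax.comp_line (c i))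
        (d1.mono fun t ht => ht.fun_neg) d2.fun_neg).2
      rw [dirDeriv_dirDeriv hΩ hu hy, hc, real_inner_self_eq_norm_sq, c.orthonormal.1 i] at this
      linarith
    have e1 := equation y hy μ hμ
    have e2 := equation x hx lam heta
    have h3 : 0 ≤ ((n : ℝ) - 1) * ∑ i, μ i :=
      mul_nonneg (by linarith) (Finset.sum_nonneg fun i _ => hpos i)
    linarith [hf x hx, hfN y hy]

/-- A bound for `(-u) u_ξξ exp((A/2)|Du|²)` at all points of `Ω` and in all directions follows from
a bound at its interior local maxima, taken in the direction of a top eigenvector. The function is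
maximized over the compact set of `(x, ξ)` with `x` in the closure of `Ω`, on which it is defined
through the continuous extensions of `Du` and `D²u`; it vanishes on the boundary. -/
lemma neg_mul_hessian_le_of_local {Ω : Set (EuclideanSpace ℝ (Fin n))}
    (hn : 0 < n) (hΩ : IsOpen Ω) (hne : Ω.Nonempty)
    (hb : Bornology.IsBounded Ω) {u : EuclideanSpace ℝ (Fin n) → ℝ} (hu : ContDiffOn ℝ 2 u Ω)
    (hub : ContDiffUpToBoundary 2 u Ω) (h0 : ∀ x ∈ frontier Ω, u x = 0) {K A C : ℝ} (hA : 0 ≤ A)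
    (hC : 0 ≤ C) (huK : ∀ x ∈ Ω, -u x ≤ K) (hDu : ∀ x ∈ Ω, ‖fderiv ℝ u x‖ ≤ K)
    (hloc : ∀ x ∈ Ω, u x < 0 →
      ∀ (b : OrthonormalBasis (Fin n) ℝ (EuclideanSpace ℝ (Fin n))) (lam : Fin n → ℝ) (i₀ : Fin n),
      (∀ i v, fderiv ℝ (fderiv ℝ u) x v (b i) = lam i * ⟪b i, v⟫_ℝ) →
      (etaEigenvalues u x = Finset.univ.val.map fun i => ∑ j, lam j - lam i) →
      (∀ i, lam i ≤ lam i₀) → 1 ≤ lam i₀ →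
      IsLocalMax (fun y => Real.log (-u y) + Real.log (dirDeriv (b i₀) (dirDeriv (b i₀) u) y) +
        A / 2 * ∑ k, dirDeriv (b k) u y ^ 2) x →
      -u x * lam i₀ ≤ C) :
    ∀ x ∈ Ω, u x < 0 → ∀ ξ : EuclideanSpace ℝ (Fin n), ‖ξ‖ = 1 →
      -u x * fderiv ℝ (fderiv ℝ u) x ξ ξ ≤ max C K * Real.exp (A / 2 * K ^ 2) := by
  obtain ⟨-, huc, hext⟩ := hub
  obtain ⟨G₁, hG₁, hG₁'⟩ := hext 1 (by norm_num)
  obtain ⟨G₂, hG₂, hG₂'⟩ := hext 2 le_rfl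
  have : Nonempty (Fin n) := ⟨⟨0, hn⟩⟩
  have hK : 0 ≤ K := by
    obtain ⟨x, hx⟩ := hne
    exact (norm_nonneg _).trans (hDu x hx)
  set Φ : EuclideanSpace ℝ (Fin n) × EuclideanSpace ℝ (Fin n) → ℝ := fun q =>
    max (-u q.1) 0 * G₂ q.1 ![q.2, q.2] * Real.exp (A / 2 * ‖G₁ q.1‖ ^ 2) with hΦ
  have hΦΩ : ∀ x ∈ Ω, ∀ ξ, Φ (x, ξ) = max (-u x) 0 * fderiv ℝ (fderiv ℝ u) x ξ ξ *
      Real.exp (A / 2 * ‖fderiv ℝ u x‖ ^ 2) := by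
    intro x hx ξ
    simp only [hΦ, hG₂' hx, hG₁' hx, norm_iteratedFDeriv_one, iteratedFDeriv_two_apply]
    rfl
  set D := closure Ω ×ˢ sphere (0 : EuclideanSpace ℝ (Fin n)) 1 with hD
  have hfst : MapsTo Prod.fst D (closure Ω) := fun q hq => hq.1
  have hcont : ContinuousOn Φ D := by
    have c1 : ContinuousOn (fun q : EuclideanSpace ℝ (Fin n) × EuclideanSpace ℝ (Fin n) => u q.1)
        D := huc.comp continuousOn_fst hfst
    have c2 : ContinuousOn (fun q : EuclideanSpace ℝ (Fin n) × EuclideanSpace ℝ (Fin n) => G₁ q.1)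
        D := hG₁.comp continuousOn_fst hfst
    have c3 : ContinuousOn (fun q : EuclideanSpace ℝ (Fin n) × EuclideanSpace ℝ (Fin n) => G₂ q.1)
        D := hG₂.comp continuousOn_fst hfst
    have c4 : ContinuousOn (fun q : EuclideanSpace ℝ (Fin n) × EuclideanSpace ℝ (Fin n) =>
        (![q.2, q.2] : Fin 2 → EuclideanSpace ℝ (Fin n))) D := by
      refine continuousOn_pi.mpr fun i => ?_
      fin_cases i <;> exact continuousOn_snd
    have c5 : ContinuousOn (fun q : EuclideanSpace ℝ (Fin n) × EuclideanSpace ℝ (Fin n) =>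
        G₂ q.1 ![q.2, q.2]) D := c3.eval c4
    have c6 : ContinuousOn (fun q : EuclideanSpace ℝ (Fin n) × EuclideanSpace ℝ (Fin n) =>
        max (-u q.1) 0) D := c1.neg.sup continuousOn_const
    exact (c6.mul c5).mul (Real.continuous_exp.comp_continuousOn
      (continuousOn_const.mul (c2.norm.pow 2)))
  have hcomp : IsCompact D := hb.isCompact_closure.prod (isCompact_sphere _ _)
  have hDne : D.Nonempty := by
    obtain ⟨x, hx⟩ := hne
    exact ⟨(x, EuclideanSpace.single ⟨0, hn⟩ 1), subset_closure hx, by simp⟩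
  obtain ⟨⟨p, ξ⟩, ⟨hp, hξ⟩, hmax⟩ := hcomp.exists_isMaxOn hDne hcont
  have hξ1 : ‖ξ‖ = 1 := by simpa using hξ
  have hexp : ∀ x ∈ Ω, Real.exp (A / 2 * ‖fderiv ℝ u x‖ ^ 2) ≤ Real.exp (A / 2 * K ^ 2) := by
    intro x hx
    gcongr
    exact hDu x hx
  have hbound : Φ (p, ξ) ≤ max C K * Real.exp (A / 2 * K ^ 2) := by
    rcases le_or_gt (Φ (p, ξ)) 0 with hle | hpos
    · exact hle.trans (mul_nonneg (hC.trans (le_max_left _ _)) (Real.exp_pos _).le)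
    have hup : u p < 0 := by
      by_contra hcon
      push Not at hcon
      have : max (-u p) 0 = 0 := max_eq_right (by linarith)
      simp [hΦ, this] at hpos
    have hpΩ : p ∈ Ω := by
      by_contra hcon
      have := h0 p ⟨hp, by rwa [hΩ.interior_eq]⟩
      linarith
    obtain ⟨b, lam, hB, heta⟩ := exists_hessian_eigenbasis u p (fderiv_fderiv_comm hΩ hu hpΩ)
    obtain ⟨i₀, hi₀⟩ := Finite.exists_max lam
    have hBi : ∀ i, fderiv ℝ (fderiv ℝ u) p (b i) (b i) = lam i := fun i => by
      rw [hB, real_inner_self_eq_norm_sq, b.orthonormal.1 i]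
      ring
    have hpu : max (-u p) 0 = -u p := max_eq_left (by linarith)
    have hexp0 := Real.exp_pos (A / 2 * ‖fderiv ℝ u p‖ ^ 2)
    -- The top eigenvector is also a maximizing direction.
    have htop : Φ (p, ξ) ≤ Φ (p, b i₀) := by
      rw [hΦΩ p hpΩ, hΦΩ p hpΩ, hpu, hBi]
      refine mul_le_mul_of_nonneg_right (mul_le_mul_of_nonneg_left ?_ (by linarith)) hexp0.le
      exact bilin_self_le hB hi₀ hξ1
    have hval : Φ (p, b i₀) = -u p * lam i₀ * Real.exp (A / 2 * ‖fderiv ℝ u p‖ ^ 2) := by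
      rw [hΦΩ p hpΩ, hpu, hBi]
    have hL0 : 0 < lam i₀ := by
      have h1 : 0 < -u p * lam i₀ * Real.exp (A / 2 * ‖fderiv ℝ u p‖ ^ 2) := by
        rw [← hval]; exact hpos.trans_le htop
      have h2 : 0 < -u p * lam i₀ := pos_of_mul_pos_left h1 hexp0.le
      exact pos_of_mul_pos_right h2 (by linarith)
    have hkey : -u p * lam i₀ ≤ max C K := by
      rcases le_or_gt (lam i₀) 1 with h1 | h1
      · calc -u p * lam i₀ ≤ -u p * 1 := by gcongr; linarith
          _ ≤ max C K := by rw [mul_one]; exact (huK p hpΩ).trans (le_max_right _ _)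
      refine (hloc p hpΩ hup b lam i₀ hB heta hi₀ h1.le ?_).trans (le_max_left _ _)
      set w := dirDeriv (b i₀) (dirDeriv (b i₀) u) with hw
      have hwp : w p = lam i₀ := by rw [hw, dirDeriv_dirDeriv hΩ hu hpΩ, hBi]
      have huc' : ContinuousAt u p := (hu.continuousOn).continuousAt (hΩ.mem_nhds hpΩ)
      have hwc : ContinuousAt w p := by
        have h1 : ContDiffOn ℝ 0 w Ω := ContDiffOn.dirDeriv (m := 0) hΩ
          (ContDiffOn.dirDeriv (m := 1) hΩ hu _) _
        exact h1.continuousOn.continuousAt (hΩ.mem_nhds hpΩ)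
      have hlogΦ : ∀ y ∈ Ω, u y < 0 → 0 < w y → Real.log (-u y) + Real.log (w y) +
          A / 2 * ∑ k, dirDeriv (b k) u y ^ 2 = Real.log (Φ (y, b i₀)) ∧ 0 < Φ (y, b i₀) := by
        intro y hy huy hwy
        have e : Φ (y, b i₀) = -u y * w y * Real.exp (A / 2 * ‖fderiv ℝ u y‖ ^ 2) := by
          rw [hΦΩ y hy, max_eq_left (by linarith), hw, dirDeriv_dirDeriv hΩ hu hy]
        have h2 : 0 < -u y := by linarith
        rw [e]
        refine ⟨?_, by positivity⟩
        rw [sum_sq_dirDeriv, Real.log_mul (by positivity) (Real.exp_pos _).ne',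
          Real.log_mul h2.ne' hwy.ne', Real.log_exp]
      filter_upwards [hΩ.mem_nhds hpΩ, huc'.eventually_lt_const hup,
        hwc.eventually_const_lt (hwp ▸ hL0)] with y hy huy hwy
      obtain ⟨e1, e2⟩ := hlogΦ y hy huy hwy
      obtain ⟨e3, -⟩ := hlogΦ p hpΩ hup (hwp ▸ hL0)
      rw [e1, e3]
      refine Real.log_le_log e2 (le_trans ?_ htop)
      exact hmax ⟨subset_closure hy, by simp⟩
    refine htop.trans (hval.trans_le ?_)
    exact mul_le_mul hkey (hexp p hpΩ) hexp0.le (hC.trans (le_max_left _ _))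
  intro x hx hux η hη
  rcases le_or_gt (fderiv ℝ (fderiv ℝ u) x η η) 0 with hle | hpos
  · refine (mul_nonpos_of_nonneg_of_nonpos (by linarith) hle).trans ?_
    exact mul_nonneg (hC.trans (le_max_left _ _)) (Real.exp_pos _).le
  · have h1 : Φ (x, η) ≤ Φ (p, ξ) := hmax ⟨subset_closure hx, by simpa using hη⟩
    refine le_trans ?_ (h1.trans hbound)
    rw [hΦΩ x hx, max_eq_left (by linarith)]
    refine le_mul_of_one_le_right (mul_nonneg (by linarith) hpos.le) ?_
    exact Real.one_le_exp (by positivity)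

end Pogorelov

theorem theorem3 (n k l : ℕ) (hlk : l < k) (hkn : k < n) (m : ℝ) (hm : 0 < m) (N K : ℝ≥0) :
    ∃ C : ℝ, ∀ (α : ℝ) (Ω : Set (EuclideanSpace ℝ (Fin n)))
      (f : EuclideanSpace ℝ (Fin n) × ℝ × EuclideanSpace ℝ (Fin n) → ℝ)
      (u : EuclideanSpace ℝ (Fin n) → ℝ),
      0 ≤ α →
      IsOpen Ω → IsConnected Ω → Bornology.IsBounded Ω →
      ContDiffUpToBoundary 2 f (Ω ×ˢ univ) →
      (∀ x ∈ closure Ω, ∀ z p, 0 < f (x, z, p)) →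
      ContDiffOn ℝ 4 u Ω → ContDiffUpToBoundary 2 u Ω →
      IsAdmissible (k - 1) u Ω →
      SolvesSumHessianQuotient k l α f u Ω →
      (∀ x ∈ frontier Ω, u x = 0) →
      cNorm 1 u Ω ≤ K →
      cNorm 2 f (Ω ×ˢ closedBall (0 : ℝ) K ×ˢ closedBall (0 : EuclideanSpace ℝ (Fin n)) K) ≤ N →
      (∀ q ∈ Ω ×ˢ closedBall (0 : ℝ) K ×ˢ closedBall (0 : EuclideanSpace ℝ (Fin n)) K, m ≤ f q) →
      ∀ x ∈ Ω, (-u x) * ‖iteratedFDeriv ℝ 2 u x‖ ≤ C := by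
  have hn1 : (1 : ℝ) ≤ n := by exact_mod_cast (by omega : 1 ≤ n)
  have hkl : (0 : ℝ) ≤ k - l := by
    have : (l : ℝ) < k := by exact_mod_cast hlk
    linarith
  obtain ⟨c, hc, hmaj⟩ := exists_majorant_log_sumQuotient hlk hkn (N : ℝ)
  obtain ⟨C₀, hC₀⟩ := exists_bound_at_isLocalMax n (M := n + N) K.coe_nonneg hc hkl
    (by positivity) hm N.coe_nonneg
  set A : ℝ := (4 * (K : ℝ) ^ 2 + 1)⁻¹ with hA
  set C₁ : ℝ := max (max C₀ 0) K * Real.exp (A / 2 * (K : ℝ) ^ 2) with hC₁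
  have hC₁0 : 0 ≤ C₁ := mul_nonneg ((le_max_right _ _).trans (le_max_left _ _)) (Real.exp_pos _).le
  refine ⟨K * N + n * C₁, ?_⟩
  intro α Ω f u hα hΩ hconn hbdd hf _ hu hub hadm hsol h0 huK hfN hfm x hx
  have hCpos : 0 ≤ (K : ℝ) * N + n * C₁ := by positivity
  rcases le_or_gt 0 (u x) with hux | hux
  · exact (mul_nonpos_of_nonpos_of_nonneg (by linarith) (norm_nonneg _)).trans hCpos
  have hu2 : ContDiffOn ℝ 2 u Ω := hub.1
  have hu0 : ∀ y ∈ Ω, |u y| ≤ K := fun y hy => by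
    have := norm_iteratedFDeriv_le_of_cNorm_le huK (zero_le_one) hy
    rwa [norm_iteratedFDeriv_zero, Real.norm_eq_abs] at this
  have hDu : ∀ y ∈ Ω, ‖fderiv ℝ u y‖ ≤ K := fun y hy => by
    have := norm_iteratedFDeriv_le_of_cNorm_le huK le_rfl hy
    rwa [norm_iteratedFDeriv_one] at this
  have hmem : ∀ y ∈ Ω, (y, u y, gradient u y) ∈
      Ω ×ˢ closedBall (0 : ℝ) K ×ˢ closedBall (0 : EuclideanSpace ℝ (Fin n)) K := fun y hy =>
    ⟨hy, by simpa using hu0 y hy, by simpa [norm_gradient] using hDu y hy⟩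
  have hfy : ∀ y ∈ Ω, m ≤ f (y, u y, gradient u y) := fun y hy => hfm _ (hmem y hy)
  have hfpos : ∀ y ∈ Ω, 0 < f (y, u y, gradient u y) := fun y hy => hm.trans_le (hfy y hy)
  have hfle : ∀ y ∈ Ω, f (y, u y, gradient u y) ≤ N := fun y hy => by
    have := norm_iteratedFDeriv_le_of_cNorm_le hfN (i := 0) (by norm_num) (hmem y hy)
    rw [norm_iteratedFDeriv_zero, Real.norm_eq_abs] at this
    exact (le_abs_self _).trans this
  have hneg : ∃ y ∈ Ω, u y < 0 := ⟨x, hx, hux⟩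
  have htrace : ∀ y ∈ Ω, ∀ lam : Fin n → ℝ,
      (etaEigenvalues u y = Finset.univ.val.map fun i => ∑ j, lam j - lam i) →
      -(N : ℝ) ≤ ∑ i, lam i := fun y hy lam heta =>
    neg_le_sum_eigenvalues hlk hkn hα hΩ hbdd hu2 hub.2.1 hadm hsol h0 hfpos hfle hneg hy heta
  -- An upper bound for the eigenvalues and the lower bound for their sum bound them below.
  have hlower : ∀ (lam : Fin n → ℝ) (B s : ℝ), 0 ≤ B → (∀ i, lam i ≤ B) → -s ≤ ∑ i, lam i →
      0 ≤ s → ∀ i, |lam i| ≤ s + n * B := by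
    intro lam B s hB hle hs hs0 i
    have h1 : ∑ j ∈ Finset.univ.erase i, lam j ≤ ((n : ℝ) - 1) * B := by
      calc _ ≤ ∑ j ∈ Finset.univ.erase i, B := Finset.sum_le_sum fun j _ => hle j
        _ = _ := by
          rw [Finset.sum_const, Finset.card_erase_of_mem (Finset.mem_univ i), Finset.card_univ,
            Fintype.card_fin, nsmul_eq_mul, Nat.cast_sub (by omega), Nat.cast_one]
    have h2 := Finset.add_sum_erase Finset.univ lam (Finset.mem_univ i)
    rw [abs_le]
    constructor
    · linarith
    · have : B ≤ n * B := le_mul_of_one_le_left hB hn1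
      linarith [hle i]
  have hall := neg_mul_hessian_le_of_local (C := max C₀ 0) (A := A) (by omega) hΩ hconn.nonempty
    hbdd hu2 hub h0 (by positivity) (le_max_right _ _)
    (fun y hy => (neg_le_abs _).trans (hu0 y hy)) hDu (by
      intro y hy huy b lam i₀ hB heta htop h1 hP
      obtain ⟨hG, hQ⟩ := inGardingCone_etaAlpha hlk hα hadm hsol hy (hfpos y hy) heta
      obtain ⟨d, hd1, hd0, hd2, hd3⟩ := hmaj α lam hα hG (hQ.trans_le (hfle y hy))
      have hY : (y, u y, ∑ k, dirDeriv (b k) u y • b k) = (y, u y, gradient u y) := by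
        rw [gradient_eq_sum b]
      have hfd := norm_iteratedFDeriv_le_of_cNorm_le hfN (i := 1) (by norm_num) (hmem y hy)
      have hfdd := norm_iteratedFDeriv_le_of_cNorm_le hfN (i := 2) le_rfl (hmem y hy)
      rw [norm_iteratedFDeriv_one] at hfd
      rw [norm_iteratedFDeriv_two] at hfdd
      refine (hC₀ Ω y u f b lam d i₀ _ hΩ hy hu hf.1 huy ((neg_le_abs _).trans (hu0 y hy))
        (hDu y hy) hB h1 (fun i => ?_) hd0 hd1 hd2 rfl (by rw [hY]; exact hfy y hy)
        (by rw [hY]; exact hfd) (by rw [hY]; exact hfdd) hP ?_).trans (le_max_left _ _)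
      · refine (hlower lam (lam i₀) N (by linarith) htop (htrace y hy lam heta)
          N.coe_nonneg i).trans ?_
        have : (N : ℝ) ≤ N * lam i₀ := le_mul_of_one_le_right N.coe_nonneg h1
        linarith
      · exact isLocalMax_log_sub_linearization hlk hα hΩ hu2 hadm hsol hfpos hy hB hQ hd3)
  have ha : 0 < -u x := by linarith
  obtain ⟨b, lam, hB, heta⟩ := exists_hessian_eigenbasis u x (fderiv_fderiv_comm hΩ hu2 hx)
  have hle : ∀ i, lam i ≤ C₁ / (-u x) := fun i => by
    have h1 := hall x hx hux (b i) (b.orthonormal.1 i)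
    rw [hB, real_inner_self_eq_norm_sq, b.orthonormal.1 i, one_pow, mul_one] at h1
    rw [le_div_iff₀ ha]
    linarith
  have habs := hlower lam (C₁ / (-u x)) N (by positivity) hle (htrace x hx lam heta) N.coe_nonneg
  have hM0 : 0 ≤ N + n * (C₁ / (-u x)) := by positivity
  rw [norm_iteratedFDeriv_two]
  have hnorm : ‖fderiv ℝ (fderiv ℝ u) x‖ ≤ N + n * (C₁ / (-u x)) := by
    refine ContinuousLinearMap.opNorm_le_bound₂ _ hM0 fun v w => ?_
    rw [Real.norm_eq_abs, mul_assoc]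
    exact abs_bilin_le hB habs hM0 v w
  calc -u x * ‖fderiv ℝ (fderiv ℝ u) x‖ ≤ -u x * (N + n * (C₁ / (-u x))) := by gcongr
    _ = -u x * N + n * C₁ := by rw [mul_add, mul_left_comm, mul_div_cancel₀ _ ha.ne']
    _ ≤ K * N + n * C₁ := by
      gcongr
      exact (neg_le_abs _).trans (hu0 x hx)
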